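/- Let $q:=13$. There is $\epsilon_0\in(0,1/2]$ such that for every $\epsilon$ with $0<\epsilon<\epsilon_0$ there is an integer $\Delta_0$ such that the following holds for every finite simple graph $G$ with maximum degree $\Delta\ge\Delta_0$ and no isolated edge. **Setting.** Let $d:=\lceil(1/2-\epsilon)\Delta\rceil$ and $s:=\binom{d-q}{2}-3d$. Let $B$ be the set of *big* vertices, i.e. those of degree at least $d$. Let $c$ be a proper edge colouring of $G$ with at most $\Delta+2$ colours such that, writing $S_c(u)$ for the set of colours of the edges incident to $u$, $S_c(u)\cap S_c(v)=\{c(uv)\}$ for every edge $uv$ with $\{w\in N(u)\cup N(v): d_G(w)<d\}=\{u,v\}$. For each $u\in B$ fix an arbitrary set $N^+(u)\subseteq N(u)$ of size $d$. Fix a linear order of $V(G)$; pairs of vertices are ordered lexicographically. For sets $U^+(u)$ ($u \in V(G)$, with $U^+(u)=\emptyset$ for $u\notin B$), let $U^-(v):=\{u\in B: v\in U^+(u)\}$ and $S'(u):=\{c(uv): v\in N(u),\ v\notin U^+(u)\cup U^-(u)\}$. An edge $uv$ with $u,v\in B$ is *finished* if $U^+(w)\ne\emptyset$ for all big $w\in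 N(u)\cup N(v)$; it is *bad* if moreover $d_G(u)=d_G(v)$ and $S'(u)=S'(v)$. An edge $uv$ is *fragile* if $d_G(u)=d_G(v)\le q+3$ and $d_G(w)\ge d$ for all $w\in(N(u)\cup N(v))\setminus\{u,v\}$. A pair $\{v,w\}\subseteq N^+(u)$, $v\neq w$, is *admissible* for $u$ if $v,w\notin U^-(u)$, $vw$ is not a fragile edge, and setting $U^+(u):=\{v,w\}$ does not create a bad edge incident to $u$. **Algorithm.** Start with $U^+(u)=\emptyset$ for all $u$. While some $v\in B$ has $U^+(v)=\emptyset$, perform the following *step*. Let $u$ be the first such vertex. Let $U^+(u)$ be chosen uniformly at random among the first $s$ admissible pairs for $u$, independently of the earlier choices given the current sets. Then handle the first of the following five events that occurs, if any: 1. there is $v\in N(u)$ with $|U^-(v)|=q+1$: reset all $w\in U^-(v)$; 2. there are a fragile edge $vw$ and $x\in V(G)\setminus\{u,v,w\}$ with $u\in U^-(v)$ and $x\in U^-(w)$: reset $u,x$; 3. there are distinct bad edges $vw,wx$ with $u\in N(v)\cup N(w)$: reset $u,v,x$; 4. there are two bad edges $vw,xy$ without common end such that $u\in N(v)\cup N(w)\cup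 N(x)\cup N(y)$ and $x\in U^+(w)$: reset $u,v,w,y$; 5. there are two bad edges $vw,xy$ without common end such that $u\in N(v)\cup N(w)$, and a vertex $z\notin\{v,w,x,y\}$ with $w,x\in U^-(z)$: reset $u,v,w,x,y$. Here *resetting* $a$ means setting $U^+(a):=\emptyset$, and if the event has several instances, the one handled is selected by an arbitrary fixed deterministic rule, depending on the current sets $U^+$ and the current vertex $u$. (A run in which, at some step, fewer than $s$ admissible pairs exist is regarded as never stopping.) **Conclusion.** The probability that the algorithm stops in at most $t$ steps tends to $1$ as $t\to\infty$. -/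

import Mathlib

namespace AVD

noncomputable section

/-- The constant `q`. -/
def q : ℕ := 13

/-- The number `s` of admissible pairs among which every random choice is made. -/
def numChoices (d : ℕ) : ℕ := (d - q).choose 2 - 3 * d

/-- The degree threshold `d` separating small from big vertices. -/
def threshold (ε : ℝ) (Δ : ℕ) : ℕ := ⌈(1 / 2 - ε) * (Δ : ℝ)⌉₊

section Graph

open scoped Classical

variable {V : Type*} [Fintype V] (G : SimpleGraph V) [DecidableRel G.Adj]
  (c : Sym2 V → ℕ) (d : ℕ)

/-- `c` is a proper edge colouring of `G` (only its values on edges of `G` are relevant). -/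
def IsProper : Prop :=
  ∀ u v w, G.Adj u v → G.Adj u w → v ≠ w → c s(u, v) ≠ c s(u, w)

/-- The set `S_c(u)` of colours on the edges incident to `u`. -/
def colours (u : V) : Set ℕ := {k | ∃ v, G.Adj u v ∧ c s(u, v) = k}

/-- If `u`, `v` are adjacent and are the only small vertices of `N(u) ∪ N(v)`, then `c(uv)` is
the only colour seen by both. -/
def SmallEdgesSeparated : Prop :=
  ∀ u v, G.Adj u v → {w | (G.Adj u w ∨ G.Adj v w) ∧ G.degree w < d} = {u, v} →
    colours G c u ∩ colours G c v = {c s(u, v)}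

/-- The set `B` of big vertices. -/
def big : Finset V := Finset.univ.filter fun u => d ≤ G.degree u

/-- `U⁻(v)`, the set of big vertices `u` with `v ∈ U⁺(u)`. -/
def Uminus (U : V → Finset V) (v : V) : Finset V := (big G d).filter fun u => v ∈ U u

/-- The edge `uv` links two big vertices and all big `w ∈ N(u) ∪ N(v)` have `U⁺(w) ≠ ∅`. -/
def Finished (U : V → Finset V) (u v : V) : Prop :=
  G.Adj u v ∧ u ∈ big G d ∧ v ∈ big G d ∧
    ∀ w ∈ big G d, G.Adj u w ∨ G.Adj v w → U w ≠ ∅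

/-- `S'(u)`, the set of colours of the edges incident to `u` that are not selected. -/
def unselectedColours (U : V → Finset V) (u : V) : Set ℕ :=
  {k | ∃ v, G.Adj u v ∧ v ∉ U u ∪ Uminus G d U u ∧ c s(u, v) = k}

/-- `uv` is a bad edge. -/
def Bad (U : V → Finset V) (u v : V) : Prop :=
  Finished G d U u v ∧ G.degree u = G.degree v ∧
    unselectedColours G c d U u = unselectedColours G c d U v

/-- `uv` is a fragile edge. -/
def Fragile (u v : V) : Prop :=
  G.Adj u v ∧ G.degree u = G.degree v ∧ G.degree u ≤ q + 3 ∧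
    ∀ w, G.Adj u w ∨ G.Adj v w → w ≠ u → w ≠ v → d ≤ G.degree w

/-- Set `U⁺(u) := {v, w}`. -/
def assign (U : V → Finset V) (u v w : V) : V → Finset V := Function.update U u {v, w}

/-- The unordered pair `{v, w}` of distinct vertices is admissible for `u`.
`N` is the function `N⁺`. -/
def Admissible (N : V → Finset V) (U : V → Finset V) (u v w : V) : Prop :=
  v ≠ w ∧ v ∈ N u ∧ w ∈ N u ∧ v ∉ Uminus G d U u ∧ w ∉ Uminus G d U u ∧
    (G.Adj v w → ¬ Fragile G d v w) ∧
    ∀ x, ¬ Bad G c d (assign U u v w) u x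

/-! The five types of bad events. Each set below consists of the sets of vertices that may be
reset to handle an event of the given type (one set for each instance of the structure), where
`U` is the state just after the pair of the current vertex `u` has been chosen. In particular,
an event of that type occurs if and only if the set is nonempty. -/

/-- First bad event: some `v ∈ N(u)` has `|U⁻(v)| = q + 1`. -/
def event1 (U : V → Finset V) (u : V) : Set (Finset V) :=
  {R | ∃ v, G.Adj u v ∧ (Uminus G d U v).card = q + 1 ∧ R = Uminus G d U v}

/-- Second bad event: a fragile edge `vw` and `x ∉ {u, v, w}` with `u ∈ U⁻(v)`, `x ∈ U⁻(w)`. -/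
def event2 (U : V → Finset V) (u : V) : Set (Finset V) :=
  {R | ∃ v w x, Fragile G d v w ∧ x ≠ u ∧ x ≠ v ∧ x ≠ w ∧
    u ∈ Uminus G d U v ∧ x ∈ Uminus G d U w ∧ R = {u, x}}

/-- Third bad event: distinct bad edges `vw`, `wx` with `u ∈ N(v) ∪ N(w)`. -/
def event3 (U : V → Finset V) (u : V) : Set (Finset V) :=
  {R | ∃ v w x, Bad G c d U v w ∧ Bad G c d U w x ∧ v ≠ x ∧
    (G.Adj v u ∨ G.Adj w u) ∧ R = {u, v, x}}

/-- Fourth bad event: independent bad edges `vw`, `xy` with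
`u ∈ N(v) ∪ N(w) ∪ N(x) ∪ N(y)` and `x ∈ U⁺(w)`. -/
def event4 (U : V → Finset V) (u : V) : Set (Finset V) :=
  {R | ∃ v w x y, Bad G c d U v w ∧ Bad G c d U x y ∧
    v ≠ x ∧ v ≠ y ∧ w ≠ x ∧ w ≠ y ∧
    (G.Adj v u ∨ G.Adj w u ∨ G.Adj x u ∨ G.Adj y u) ∧ x ∈ U w ∧ R = {u, v, w, y}}

/-- Fifth bad event: independent bad edges `vw`, `xy` with `u ∈ N(v) ∪ N(w)` and a vertex
`z ∉ {v, w, x, y}` with `w, x ∈ U⁻(z)`. -/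
def event5 (U : V → Finset V) (u : V) : Set (Finset V) :=
  {R | ∃ v w x y z, Bad G c d U v w ∧ Bad G c d U x y ∧
    v ≠ x ∧ v ≠ y ∧ w ≠ x ∧ w ≠ y ∧ (G.Adj v u ∨ G.Adj w u) ∧
    z ≠ v ∧ z ≠ w ∧ z ≠ x ∧ z ≠ y ∧
    w ∈ Uminus G d U z ∧ x ∈ Uminus G d U z ∧ R = {u, v, w, x, y}}

/-- The sets that may be reset after the pair of `u` has been chosen: those of the first type of
bad event that occurs. This set is empty if and only if no bad event occurs. -/
def handlings (U : V → Finset V) (u : V) : Set (Finset V) :=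
  if (event1 G d U u).Nonempty then event1 G d U u
  else if (event2 G d U u).Nonempty then event2 G d U u
  else if (event3 G c d U u).Nonempty then event3 G c d U u
  else if (event4 G c d U u).Nonempty then event4 G c d U u
  else event5 G c d U u

/-- `ρ` is a deterministic rule that chooses which instance of the triggered type of bad event
is handled, as a function of the current state and the current vertex. -/
def IsRule (ρ : (V → Finset V) → V → Finset V) : Prop :=
  ∀ U u, (handlings G c d U u).Nonempty → ρ U u ∈ handlings G c d U u

/-- Set `U⁺(a) := ∅` for all `a ∈ R`. -/
def reset (U : V → Finset V) (R : Finset V) : V → Finset V := fun a => if a ∈ R then ∅ else U a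

/-- Handle a bad event, if there is one, after the pair of `u` has been chosen. -/
def handle (ρ : (V → Finset V) → V → Finset V) (U : V → Finset V) (u : V) : V → Finset V :=
  if (handlings G c d U u).Nonempty then reset U (ρ U u) else U

/-- The big vertices `u` with `U⁺(u) = ∅`. -/
def pending (U : V → Finset V) : Finset V := (big G d).filter fun u => U u = ∅

end Graph

section Algorithm

open scoped Classical

variable {V : Type*} [Fintype V] [LinearOrder V] (G : SimpleGraph V) [DecidableRel G.Adj]
  (c : Sym2 V → ℕ) (d : ℕ) (N : V → Finset V) (ρ : (V → Finset V) → V → Finset V)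

/-- The admissible pairs for `u`; the unordered pair `{v, w}` with `v < w` is represented
by `(v, w)`, and pairs are ordered lexicographically. -/
def admissiblePairs (U : V → Finset V) (u : V) : Finset (V ×ₗ V) :=
  Finset.univ.filter fun p =>
    (ofLex p).1 < (ofLex p).2 ∧ Admissible G c d N U u (ofLex p).1 (ofLex p).2

/-- The first `s` admissible pairs for `u`. -/
def firstPairs (U : V → Finset V) (u : V) : Finset (V ×ₗ V) :=
  (((admissiblePairs G c d N U u).sort).take (numChoices d)).toFinset

/-- The state after one iteration that treats `u` and chooses the pair `p` for it. -/
def treat (U : V → Finset V) (u : V) (p : V ×ₗ V) : V → Finset V :=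
  handle G c d ρ (assign U u (ofLex p).1 (ofLex p).2) u

/-- The distribution of the state after one iteration of the loop started in state `U`; a state
in which the algorithm has stopped is kept. The value `none` means that the random choice could
not be made because fewer than `s` admissible pairs exist (or `s = 0`). -/
def step (U : V → Finset V) : PMF (Option (V → Finset V)) :=
  if h : (pending G d U).Nonempty then
    if h' : numChoices d ≤ (admissiblePairs G c d N U ((pending G d U).min' h)).card ∧
        (firstPairs G c d N U ((pending G d U).min' h)).Nonempty then
      (PMF.uniformOfFinset (firstPairs G c d N U ((pending G d U).min' h)) h'.2).map
        fun p => some (treat G c d ρ U ((pending G d U).min' h) p)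
    else PMF.pure none
  else PMF.pure (some U)

/-- The distribution of the state after at most `t` iterations, from `U⁺(u) = ∅` for all `u`. -/
def run : ℕ → PMF (Option (V → Finset V))
  | 0 => PMF.pure (some fun _ => ∅)
  | t + 1 => (run t).bind fun o => o.elim (PMF.pure none) (step G c d N ρ)

/-- The probability that the algorithm stops in at most `t` steps (a run in which some random
choice could not be made does not count as stopping). -/
def probStops (t : ℕ) : ENNReal :=
  (run G c d N ρ t).toOuterMeasure {o | ∃ U, o = some U ∧ pending G d U = ∅}

end Algorithm

end

end AVD

/-! The argument is entropy compression written as a weighted count of states. Let a state be valid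
if it is a partial selection in which every vertex is selected at most `q` times. For each set `P`,
the probabilities of surviving `t` more steps are summed over all valid states with pending set `P`,
reachable or not. The claim is that this sum is at most `C * x ^ |P| * θ ^ t` with `θ < 1`. The
initial state is one summand, so its survival probability tends to 0.

The induction on `t` follows one step. A valid state together with the chosen pair is determined by
the intermediate state that it produces, whose pending set has lost the current vertex. If no event
occurs, the intermediate state is valid. Otherwise a set `R` is reset, and the step loses
information only about `R`. A label from a finite set recovers `R` and, given the state outside `R`,
the lost selections. So the contribution of an event is at most the number of labels times the bound
for `|R|` additional pending vertices. Each random choice divides by `s`, hence the induction closes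
if `1 + ∑ (labels) * x ^ |R| ≤ s * x * θ`.

Labels can be few because a bad edge carries information. If `vw` is bad, the unselected colours at
`v` equal those at `w`, and in a proper colouring they determine what is selected at `v`; so the
selection at one end is free once the other end is known (`Bad.selection_eq`). This makes events 3
to 5 cost `O(n ^ (2 * |R| - 1))` labels, a factor `n` below `s ^ |R|`. Event 2 gains the same factor
from the bounded degrees at a fragile edge. Event 1 has no such gain, only the factor `1 / q!` for
an unordered set, and `q = 13` makes that enough. Finally, `choose_two_le_card_admissiblePairs`
shows that the `s` pairs always exist. -/

namespace AVD

/-! ### Finite codes for neighbours, selected pairs and reset sets. -/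

section Codes

variable {V : Type*}

theorem exists_code [Fintype V] {n : ℕ} (hn : 0 < n) (A : V → Finset V) (hA : ∀ u, (A u).card ≤ n) :
    ∃ e : V → V → Fin n, ∀ u, Set.InjOn (e u) (A u) := by
  classical
  have key : ∀ u, ∃ f : V → Fin n, Set.InjOn f (A u) := by
    intro u
    have : Nonempty (A u ↪ Fin n) := by
      apply Function.Embedding.nonempty_of_card_le
      simpa using hA u
    obtain ⟨g⟩ := this
    refine ⟨fun v => if h : v ∈ A u then g ⟨v, h⟩ else ⟨0, hn⟩, ?_⟩
    intro v hv w hw h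
    simp only [Finset.mem_coe] at hv hw
    simp only [hv, hw, dif_pos] at h
    simpa using g.injective h
  choose e he using key
  exact ⟨e, he⟩

open scoped Classical in
/-- A code of the two-element set `s`, obtained from a code of its elements. -/
noncomputable def pairCode {n : ℕ} (e : V → Fin n) (s : Finset V) (n0 : Fin n) : Fin n × Fin n :=
  if h : ∃ a b, s = {a, b} then (e h.choose, e h.choose_spec.choose) else (n0, n0)

/-- The ordering of the pair is picked by choice, but equal codes force the picked elements to agree
one by one, so no coherence between the choices for `s` and `s'` is needed. The value `n0` is only a
default. -/
theorem pairCode_inj {n : ℕ} {e : V → Fin n} {A s s' : Finset V} {n0 : Fin n}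
    (he : Set.InjOn e A) (hs : s ⊆ A) (hs' : s' ⊆ A) (h2 : s.card = 2) (h2' : s'.card = 2)
    (h : pairCode e s n0 = pairCode e s' n0) : s = s' := by
  classical
  have hx : ∃ a b, s = {a, b} := by
    obtain ⟨a, b, -, h⟩ := Finset.card_eq_two.1 h2
    exact ⟨a, b, h⟩
  have hx' : ∃ a b, s' = {a, b} := by
    obtain ⟨a, b, -, h⟩ := Finset.card_eq_two.1 h2'
    exact ⟨a, b, h⟩
  unfold pairCode at h
  rw [dif_pos (by convert hx), dif_pos (by convert hx')] at h
  have e1 := hx.choose_spec.choose_spec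
  have e2 := hx'.choose_spec.choose_spec
  simp only [Prod.mk.injEq] at h
  have m1 : hx.choose ∈ s := by rw [Finset.ext_iff] at e1; exact (e1 _).2 (by simp)
  have m2 : hx.choose_spec.choose ∈ s := by rw [Finset.ext_iff] at e1; exact (e1 _).2 (by simp)
  have m3 : hx'.choose ∈ s' := by rw [Finset.ext_iff] at e2; exact (e2 _).2 (by simp)
  have m4 : hx'.choose_spec.choose ∈ s' := by rw [Finset.ext_iff] at e2; exact (e2 _).2 (by simp)
  have q1 := he (hs m1) (hs' m3) h.1
  have q2 := he (hs m2) (hs' m4) h.2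
  exact e1.trans (Eq.trans (congrArg₂ (fun a b => ({a, b} : Finset V)) q1 q2) e2.symm)

open scoped Classical in
/-- A code of the element other than `z` of a two-element set `s` that contains `z`. -/
noncomputable def otherCode {n : ℕ} (e : V → Fin n) (s : Finset V) (z : V) : Fin n :=
  if h : ∃ o, s = {z, o} then e h.choose else e z

theorem otherCode_inj {n : ℕ} {e : V → Fin n} {A s s' : Finset V} {z : V}
    (he : Set.InjOn e A) (hs : s ⊆ A) (hs' : s' ⊆ A) (h2 : s.card = 2) (h2' : s'.card = 2)
    (hz : z ∈ s) (hz' : z ∈ s') (h : otherCode e s z = otherCode e s' z) : s = s' := by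
  classical
  have aux : ∀ t : Finset V, t.card = 2 → z ∈ t → ∃ o, t = {z, o} := by
    intro t ht hzt
    obtain ⟨a, b, -, h⟩ := Finset.card_eq_two.1 ht
    rw [h] at hzt
    simp only [Finset.mem_insert, Finset.mem_singleton] at hzt
    rcases hzt with rfl | rfl
    · exact ⟨b, by rw [h]⟩
    · exact ⟨a, by rw [h, Finset.pair_comm]⟩
  have hx := aux s h2 hz
  have hx' := aux s' h2' hz'
  unfold otherCode at h
  rw [dif_pos (by convert hx), dif_pos (by convert hx')] at h
  have e1 := hx.choose_spec
  have e2 := hx'.choose_spec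
  have m1 : hx.choose ∈ s := by rw [Finset.ext_iff] at e1; exact (e1 _).2 (by simp)
  have m2 : hx'.choose ∈ s' := by rw [Finset.ext_iff] at e2; exact (e2 _).2 (by simp)
  have q1 := he (hs m1) (hs' m2) h
  refine e1.trans (Eq.trans ?_ e2.symm)
  rw [q1]

open scoped Classical in
/-- Which vertices of `τ` are selected by which ones. -/
noncomputable def incidence {k : ℕ} (M : V → Finset V) (τ : Fin k → V) : Fin k → Fin k → Bool :=
  fun i j => decide (τ j ∈ M (τ i))

theorem mem_iff_of_incidence_eq {k : ℕ} {M M' : V → Finset V} {τ : Fin k → V}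
    (h : incidence M τ = incidence M' τ) (i j : Fin k) : τ j ∈ M (τ i) ↔ τ j ∈ M' (τ i) := by
  have := congrFun (congrFun h i) j
  simpa [incidence] using this

/-- The pairs `(M, R)` with the property `E` have labels in `L` from which `R` can be read off,
and also `M` provided that `M` is known outside `R`. -/
def EncodedBy (E : (V → Finset V) → Finset V → Prop) (L : Type) : Prop :=
  ∃ code : (V → Finset V) → Finset V → L → Prop, (∀ M R, E M R → ∃ l, code M R l) ∧
    ∀ M R M' R' l, code M R l → code M' R' l → R = R' ∧ ((∀ a ∉ R, M a = M' a) → M = M')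

end Codes

/-! ### Partial selections, and the rigidity of bad edges. -/

section Graph

open scoped Classical

variable {V : Type*} [Fintype V] {G : SimpleGraph V} [DecidableRel G.Adj]
  {c : Sym2 V → ℕ} {d : ℕ} {N : V → Finset V} {U M M' : V → Finset V} {u v w x : V}

theorem mem_big : u ∈ big G d ↔ d ≤ G.degree u := by simp [big]

theorem mem_Uminus : u ∈ Uminus G d U v ↔ u ∈ big G d ∧ v ∈ U u := by simp [Uminus]

theorem mem_pending : u ∈ pending G d U ↔ u ∈ big G d ∧ U u = ∅ := by simp [pending]

/-- In a proper colouring a colour identifies the edge at `u` that bears it, so the set of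
unselected colours determines the set of selected neighbours. -/
theorem mem_selected_of_unselectedColours_eq (hc : IsProper G c)
    (h : unselectedColours G c d M u = unselectedColours G c d M' v) (hv : G.Adj u w)
    (huv : u = v) (hw : w ∈ M u ∪ Uminus G d M u) : w ∈ M' u ∪ Uminus G d M' u := by
  subst huv
  by_contra hcon
  have : c s(u, w) ∈ unselectedColours G c d M' u := ⟨w, hv, hcon, rfl⟩
  rw [← h] at this
  obtain ⟨w', h1, h2, h3⟩ := this
  by_cases hww : w' = w
  · subst hww; exact h2 hw
  · exact hc u w' w h1 hv hww h3

theorem Bad.symm (h : Bad G c d M v w) : Bad G c d M w v := by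
  obtain ⟨⟨h1, h2, h3, h4⟩, h5, h6⟩ := h
  exact ⟨⟨h1.symm, h3, h2, fun a ha h => h4 a ha h.symm⟩, h5.symm, h6.symm⟩

theorem Bad.adj (h : Bad G c d M v w) : G.Adj v w := h.1.1

theorem Bad.left_nonempty (h : Bad G c d M v w) : M v ≠ ∅ :=
  h.1.2.2.2 v h.1.2.1 (Or.inr h.1.1.symm)

theorem Bad.left_mem_big (h : Bad G c d M v w) : v ∈ big G d := h.1.2.1

variable (G d N) in
/-- Every big vertex has selected nothing or two of its neighbours in `N`, the other vertices have
selected nothing, and no edge is selected from both ends. -/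
structure Oriented (U : V → Finset V) : Prop where
  sub : ∀ a, U a ⊆ N a
  adj : ∀ a, ∀ b ∈ U a, G.Adj a b
  eq_empty : ∀ a, a ∉ big G d → U a = ∅
  card : ∀ a, U a ≠ ∅ → (U a).card = 2
  asymm : ∀ a b, a ∈ U b → b ∉ U a

variable (G d N) in
/-- The states of the algorithm in which no vertex is selected too often. -/
structure Valid (U : V → Finset V) : Prop extends Oriented G d N U where
  indegree : ∀ v, (Uminus G d U v).card ≤ q

variable (G c d N) in
/-- The states of the algorithm just after a pair has been chosen for `u`. -/
structure Intermediate (u : V) (M : V → Finset V) : Prop extends Oriented G d N M where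
  mem_big : u ∈ big G d
  nonempty : M u ≠ ∅
  not_bad : ∀ x, ¬ Bad G c d M u x
  indegree : ∀ v, (Uminus G d (Function.update M u ∅) v).card ≤ q

theorem Oriented.mem_big (h : Oriented G d N U) (hv : v ∈ U u) : u ∈ big G d := by
  by_contra hu
  simp [h.eq_empty u hu] at hv

theorem Oriented.mem_Uminus (h : Oriented G d N U) : u ∈ Uminus G d U v ↔ v ∈ U u :=
  ⟨fun hu => (AVD.mem_Uminus.1 hu).2, fun hu => AVD.mem_Uminus.2 ⟨h.mem_big hu, hu⟩⟩

theorem Oriented.card_of_mem (h : Oriented G d N U) (hv : v ∈ U u) : (U u).card = 2 :=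
  h.card u (Finset.ne_empty_of_mem hv)

theorem Oriented.subset_neighborFinset (h : Oriented G d N U) : U u ⊆ G.neighborFinset u := by
  intro a ha
  simpa using h.adj u a ha

theorem Oriented.mono (h : Oriented G d N M) (hU : ∀ a, U a = ∅ ∨ U a = M a) :
    Oriented G d N U where
  sub a := by rcases hU a with h' | h' <;> rw [h']; exacts [Finset.empty_subset _, h.sub a]
  adj a b hb := by
    rcases hU a with h' | h' <;> rw [h'] at hb
    · simp at hb
    · exact h.adj a b hb
  eq_empty a ha := by rcases hU a with h' | h' <;> rw [h']; exact h.eq_empty a ha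
  card a ha := by
    rcases hU a with h' | h'
    · exact absurd h' ha
    · rw [h'] at ha ⊢; exact h.card a ha
  asymm a b hab := by
    rcases hU b with h' | h' <;> rw [h'] at hab
    · simp at hab
    · rcases hU a with h'' | h'' <;> rw [h'']
      · simp
      · exact h.asymm a b hab

theorem Valid.mono (h : Valid G d N M) (hU : ∀ a, U a = ∅ ∨ U a = M a) : Valid G d N U where
  toOriented := h.toOriented.mono hU
  indegree v := by
    refine (Finset.card_le_card ?_).trans (h.indegree v)
    intro a ha
    rw [AVD.mem_Uminus] at ha ⊢
    refine ⟨ha.1, ?_⟩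
    rcases hU a with h' | h'
    · rw [h'] at ha; simp at ha
    · rw [← h']; exact ha.2

theorem valid_empty : Valid G d N (fun _ => ∅) where
  sub a := by simp
  adj a := by simp
  eq_empty a := by simp
  card a := by simp
  asymm a := by simp
  indegree v := by simp [Uminus]

theorem Valid.intermediate (hN : ∀ u ∈ big G d, N u ⊆ G.neighborFinset u ∧ (N u).card = d)
    (h : Valid G d N U) (hu : u ∈ pending G d U) (hp : Admissible G c d N U u v w) :
    Intermediate G c d N u (assign U u v w) := by
  obtain ⟨hb, he⟩ := AVD.mem_pending.1 hu
  obtain ⟨hvw, hv, hw, hv', hw', -, hbad⟩ := hp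
  have hav : G.Adj u v := by simpa using (hN u hb).1 hv
  have haw : G.Adj u w := by simpa using (hN u hb).1 hw
  have hs : assign U u v w u = {v, w} := by simp [assign]
  have hne : ∀ a, a ≠ u → assign U u v w a = U a := fun a ha => by simp [assign, ha]
  refine ⟨⟨?_, ?_, ?_, ?_, ?_⟩, hb, ?_, hbad, ?_⟩
  · intro a
    by_cases ha : a = u
    · subst ha; rw [hs]; intro b hb'; simp at hb'; rcases hb' with rfl | rfl <;> assumption
    · rw [hne a ha]; exact h.sub a
  · intro a b hb'
    by_cases ha : a = u
    · subst ha; rw [hs] at hb'; simp at hb'; rcases hb' with rfl | rfl <;> assumption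
    · rw [hne a ha] at hb'; exact h.adj a b hb'
  · intro a ha'
    by_cases ha : a = u
    · subst ha; exact absurd hb ha'
    · rw [hne a ha]; exact h.eq_empty a ha'
  · intro a ha'
    by_cases ha : a = u
    · subst ha; rw [hs]; exact Finset.card_pair hvw
    · rw [hne a ha] at ha' ⊢; exact h.card a ha'
  · intro a b hab hba
    by_cases hbu : b = u
    · subst hbu
      rw [hs] at hab
      simp only [Finset.mem_insert, Finset.mem_singleton] at hab
      have hau : a ≠ b := by rintro rfl; rcases hab with rfl | rfl <;> simp_all
      rw [hne a hau, ← h.toOriented.mem_Uminus] at hba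
      rcases hab with rfl | rfl
      · exact hv' hba
      · exact hw' hba
    · rw [hne b hbu] at hab
      by_cases hau : a = u
      · subst hau
        rw [hs] at hba
        rw [← h.toOriented.mem_Uminus] at hab
        simp only [Finset.mem_insert, Finset.mem_singleton] at hba
        rcases hba with rfl | rfl
        · exact hv' hab
        · exact hw' hab
      · rw [hne a hau] at hba
        exact h.asymm a b hab hba
  · rw [hs]; simp
  · have : Function.update (assign U u v w) u ∅ = U := by
      rw [assign, Function.update_idem, ← he, Function.update_eq_self]
    rw [this]; exact h.indegree

-- The treated vertex had an empty selection before, so the new state remembers both the old state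
-- and the chosen pair. This lets the induction pass to a sum over intermediate states without loss.
set_option linter.unusedSectionVars false in
theorem assign_inj {U U' : V → Finset V} {v' w' : V} (hU : U u = ∅) (hU' : U' u = ∅)
    (h : assign U u v w = assign U' u v' w') :
    U = U' ∧ ∀ a, (a = v ∨ a = w) ↔ (a = v' ∨ a = w') := by
  constructor
  · funext a
    by_cases ha : a = u
    · subst ha; rw [hU, hU']
    · have := congrFun h a
      simpa [assign, ha] using this
  · intro a
    have := congrFun h u
    simp only [assign, Function.update_self] at this
    have := Finset.ext_iff.1 this a
    simpa using this

/-- Of the lost selections, only the bits "does `a ∈ R` select `v`" affect `U⁻(v)`. This is why a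
bounded `incidence` table in a label suffices. -/
theorem Uminus_eq_of_agree {R : Finset V} (h : ∀ a ∉ R, M a = M' a)
    (h' : ∀ a ∈ R, (v ∈ M a ↔ v ∈ M' a)) : Uminus G d M v = Uminus G d M' v := by
  ext a
  rw [mem_Uminus, mem_Uminus]
  by_cases ha : a ∈ R
  · rw [h' a ha]
  · rw [h a ha]

/-- The selection at one end of a bad edge is determined by the rest of the state. -/
theorem Bad.selection_eq (hc : IsProper G c) (h : Oriented G d N M) (h' : Oriented G d N M')
    (hb : Bad G c d M v w) (hb' : Bad G c d M' v w) (hw : M w = M' w)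
    (hv' : Uminus G d M v = Uminus G d M' v) (hw' : Uminus G d M w = Uminus G d M' w) :
    M v = M' v := by
  -- The selected neighbours of `w` agree in both states, and badness transports its unselected
  -- colours to `v`.
  have key : unselectedColours G c d M v = unselectedColours G c d M' v := by
    rw [hb.2.2, hb'.2.2]
    simp only [unselectedColours, hw, hw']
  -- Selected neighbours of `v` lie in `M v` or in `U⁻(v)`. These are disjoint, as no edge is
  -- selected from both ends, so knowing the union and `U⁻(v)` gives `M v`.
  ext a
  constructor
  · intro ha
    have := mem_selected_of_unselectedColours_eq hc key (h.adj v a ha) rfl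
      (Finset.mem_union_left _ ha)
    rcases Finset.mem_union.1 this with h1 | h1
    · exact h1
    · rw [← hv', h.mem_Uminus] at h1
      exact absurd ha (h.asymm _ _ h1)
  · intro ha
    have := mem_selected_of_unselectedColours_eq hc key.symm (h'.adj v a ha) rfl
      (Finset.mem_union_left _ ha)
    rcases Finset.mem_union.1 this with h1 | h1
    · exact h1
    · rw [hv', h'.mem_Uminus] at h1
      exact absurd ha (h'.asymm _ _ h1)

end Graph

/-! ### Labels for the five types of event. -/

section Graph

open scoped Classical

variable {V : Type*} [Fintype V] {G : SimpleGraph V} [DecidableRel G.Adj]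
  {c : Sym2 V → ℕ} {d n : ℕ} {N : V → Finset V} {U M M' : V → Finset V} {u v w x : V}

variable (G) in
/-- A code of an edge `vw` with `u ∈ N(v) ∪ N(w)`. -/
noncomputable def edgeCode (e : V → V → Fin n) (u v w : V) : Bool × Fin n × Fin n :=
  if G.Adj v u then (true, e u v, e v w) else (false, e u w, e w v)

set_option linter.unusedSectionVars false in
theorem edgeCode_inj {e : V → V → Fin n} (he : ∀ u, Set.InjOn (e u) (G.neighborFinset u))
    {v' w' : V} (h : G.Adj v w) (h' : G.Adj v' w') (hu : G.Adj v u ∨ G.Adj w u)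
    (hu' : G.Adj v' u ∨ G.Adj w' u) (heq : edgeCode G e u v w = edgeCode G e u v' w') :
    v = v' ∧ w = w' := by
  have he' : ∀ u {a b}, G.Adj u a → G.Adj u b → e u a = e u b → a = b := by
    intro u a b ha hb hab
    exact he u (by simpa using ha) (by simpa using hb) hab
  unfold edgeCode at heq
  by_cases h1 : G.Adj v u <;> by_cases h2 : G.Adj v' u <;> simp [h1, h2] at heq
  · have := he' u h1.symm h2.symm heq.1
    subst this
    exact ⟨rfl, he' v h h' heq.2⟩
  · have := he' u (hu.resolve_left h1).symm (hu'.resolve_left h2).symm heq.1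
    subst this
    exact ⟨he' w h.symm h'.symm heq.2, rfl⟩

theorem Intermediate.selection_eq {e : V → Fin n} {A : Finset V} {n0 : Fin n}
    (hM : Intermediate G c d N u M) (hM' : Intermediate G c d N u M') (he : Set.InjOn e A)
    (hA : M u ⊆ A) (hA' : M' u ⊆ A) (h : pairCode e (M u) n0 = pairCode e (M' u) n0) :
    M u = M' u :=
  pairCode_inj he hA hA' (hM.card u hM.nonempty) (hM'.card u hM'.nonempty) h

theorem Oriented.selection_eq {e : V → Fin n} {A : Finset V}
    (hM : Oriented G d N M) (hM' : Oriented G d N M') (he : Set.InjOn e A)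
    (hA : M w ⊆ A) (hA' : M' w ⊆ A) (hv : v ∈ M w) (hv' : v ∈ M' w)
    (h : otherCode e (M w) v = otherCode e (M' w) v) : M w = M' w :=
  otherCode_inj he hA hA' (hM.card_of_mem hv) (hM'.card_of_mem hv') hv hv' h

theorem Intermediate.ne_of_bad (hM : Intermediate G c d N u M) (h : Bad G c d M v w) :
    u ≠ v ∧ u ≠ w := by
  constructor
  · rintro rfl; exact hM.not_bad _ h
  · rintro rfl; exact hM.not_bad _ h.symm

set_option linter.unusedSectionVars false in
theorem eq_of_agree {R : Finset V} (h : ∀ a ∉ R, M a = M' a) (h' : ∀ a ∈ R, M a = M' a) :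
    M = M' := by
  funext a
  by_cases ha : a ∈ R
  exacts [h' a ha, h a ha]

/-- In an intermediate state all vertices are selected at most `q + 1` times, and those selected
that often are selected by the current vertex. -/
theorem Intermediate.mem_of_card_Uminus (hM : Intermediate G c d N u M)
    (h : q < (Uminus G d M v).card) : v ∈ M u := by
  by_contra hv
  refine absurd (hM.indegree v) (not_le.2 (lt_of_lt_of_le h (Finset.card_le_card ?_)))
  intro a ha
  rw [mem_Uminus] at ha ⊢
  have : a ≠ u := by rintro rfl; exact hv ha.2
  simpa [this] using ha

theorem Intermediate.card_Uminus_le (hM : Intermediate G c d N u M) :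
    (Uminus G d M v).card ≤ q + 1 := by
  have : Uminus G d M v ⊆ insert u (Uminus G d (Function.update M u ∅) v) := by
    intro a ha
    by_cases hau : a = u
    · simp [hau]
    · rw [Finset.mem_insert]; right
      rw [mem_Uminus] at ha ⊢
      simpa [hau] using ha
  exact (Finset.card_le_card this).trans ((Finset.card_insert_le _ _).trans
    (Nat.succ_le_succ (hM.indegree v)))

/-- The pair of `u` is recorded as the overloaded vertex `v` and its partner, at cost `d ^ 2`. Each
of the other `q` vertices selecting `v` is recorded by its code at `v` and its second selected
vertex. Recording these as an unordered set gives `(n * d).choose q`, the only saving for this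
event. -/
theorem encodedBy_event1 {e : V → V → Fin n} (he : ∀ u, Set.InjOn (e u) (G.neighborFinset u))
    {f : V → V → Fin d} (hf : ∀ u ∈ big G d, Set.InjOn (f u) (N u)) :
    EncodedBy (fun M R => Intermediate G c d N u M ∧ R ∈ event1 G d M u)
      ((Fin d × Fin d) × {T : Finset (Fin n × Fin d) // T.card = q}) := by
  have he' : ∀ u {a b}, G.Adj u a → G.Adj u b → e u a = e u b → a = b := by
    intro u a b ha hb hab
    exact he u (by simpa using ha) (by simpa using hb) hab
  refine ⟨fun M R l => Intermediate G c d N u M ∧ ∃ v, R = Uminus G d M v ∧ v ∈ M u ∧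
    l.1 = (f u v, otherCode (f u) (M u) v) ∧
    l.2.1 = (R.erase u).image fun w => (e v w, otherCode (f w) (M w) v), ?_, ?_⟩
  · rintro M R ⟨hM, v, hv, hcard, rfl⟩
    have hu : v ∈ M u := hM.mem_of_card_Uminus (by omega)
    have hT : ((Uminus G d M v).erase u |>.image fun w =>
        (e v w, otherCode (f w) (M w) v)).card = q := ?_
    · exact ⟨(_, ⟨_, hT⟩), hM, v, rfl, hu, rfl, rfl⟩
    rw [Finset.card_image_of_injOn, Finset.card_erase_of_mem, hcard, Nat.add_sub_cancel]
    · exact hM.mem_Uminus.2 hu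
    · intro a ha b hb hab
      simp only [Finset.coe_erase, Set.mem_sdiff, Finset.mem_coe, hM.mem_Uminus] at ha hb
      exact he' v (hM.adj _ _ ha.1).symm (hM.adj _ _ hb.1).symm (Prod.ext_iff.1 hab).1
  · rintro M R M' R' l ⟨hM, v, rfl, hv, h1, h2⟩ ⟨hM', v', rfl, hv', h1', h2'⟩
    rw [h1, Prod.mk.injEq] at h1'
    have e1 := hf u hM.mem_big (hM.sub u hv) (hM'.sub u hv') h1'.1
    subst e1
    have a1 := hM.toOriented.selection_eq hM'.toOriented (hf u hM.mem_big) (hM.sub u) (hM'.sub u)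
      hv hv' h1'.2
    rw [h2] at h2'
    have key : ∀ {M M' : V → Finset V}, Intermediate G c d N u M → Intermediate G c d N u M' →
        (((Uminus G d M v).erase u).image fun w => (e v w, otherCode (f w) (M w) v)) =
          (((Uminus G d M' v).erase u).image fun w => (e v w, otherCode (f w) (M' w) v)) →
        ∀ a ∈ Uminus G d M v, a ≠ u → a ∈ Uminus G d M' v ∧ M a = M' a := by
      intro M M' hM hM' h a ha hau
      have : (e v a, otherCode (f a) (M a) v) ∈
          ((Uminus G d M' v).erase u).image fun w => (e v w, otherCode (f w) (M' w) v) := by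
        rw [← h]
        exact Finset.mem_image_of_mem _ (Finset.mem_erase.2 ⟨hau, ha⟩)
      obtain ⟨b, hb, hab⟩ := Finset.mem_image.1 this
      have hb' := (Finset.mem_erase.1 hb).2
      rw [Prod.mk.injEq] at hab
      rw [hM.mem_Uminus] at ha
      rw [hM'.mem_Uminus] at hb'
      have := he' v (hM'.adj _ _ hb').symm (hM.adj _ _ ha).symm hab.1
      subst this
      refine ⟨hM'.mem_Uminus.2 hb', ?_⟩
      exact hM.toOriented.selection_eq hM'.toOriented (hf b (hM.toOriented.mem_big ha)) (hM.sub b)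
        (hM'.sub b) ha hb' hab.2.symm
    refine ⟨?_, fun hag => eq_of_agree hag ?_⟩
    · ext a
      by_cases hau : a = u
      · subst hau; simp [hM.mem_Uminus, hM'.mem_Uminus, hv, hv']
      · exact ⟨fun ha => (key hM hM' h2' a ha hau).1, fun ha => (key hM' hM h2'.symm a ha hau).1⟩
    · intro a ha
      by_cases hau : a = u
      · subst hau; exact a1
      · exact (key hM hM' h2' a ha hau).2

/-- The path from `u` to `x` runs through `v` and `w`, both of degree at most `q + 3`, so two of its
three steps cost a constant. The pairs of `u` and `x` each contain a vertex of this path, so only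
their partners remain to be recorded. -/
theorem encodedBy_event2 {e : V → V → Fin n} (he : ∀ u, Set.InjOn (e u) (G.neighborFinset u))
    {f : V → V → Fin (q + 3)}
    (hf : ∀ u, G.degree u ≤ q + 3 → Set.InjOn (f u) (G.neighborFinset u)) :
    EncodedBy (fun M R => Intermediate G c d N u M ∧ R ∈ event2 G d M u)
      ((Fin n × Fin n) × Fin (q + 3) × Fin (q + 3) × Fin n) := by
  have he' : ∀ u {a b}, G.Adj u a → G.Adj u b → e u a = e u b → a = b := by
    intro u a b ha hb hab
    exact he u (by simpa using ha) (by simpa using hb) hab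
  have hf' : ∀ u {a b}, G.degree u ≤ q + 3 → G.Adj u a → G.Adj u b → f u a = f u b → a = b := by
    intro u a b hu ha hb hab
    exact hf u hu (by simpa using ha) (by simpa using hb) hab
  refine ⟨fun M R l => Intermediate G c d N u M ∧ ∃ v w x, Fragile G d v w ∧ x ≠ u ∧
    v ∈ M u ∧ w ∈ M x ∧ R = {u, x} ∧
    l = ((e u v, otherCode (e u) (M u) v), f v w, f w x, otherCode (e x) (M x) w), ?_, ?_⟩
  · rintro M R ⟨hM, v, w, x, h1, h2, -, -, h5, h6, h7⟩
    exact ⟨_, hM, v, w, x, h1, h2, (mem_Uminus.1 h5).2, (mem_Uminus.1 h6).2, h7, rfl⟩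
  · rintro M R M' R' l ⟨hM, v, w, x, h1, h2, h3, h4, rfl, rfl⟩
      ⟨hM', v', w', x', h1', h2', h3', h4', rfl, hl⟩
    simp only [Prod.mk.injEq] at hl
    obtain ⟨⟨l1, l2⟩, l3, l4, l5⟩ := hl
    have e1 := he' u (hM.adj _ _ h3) (hM'.adj _ _ h3') l1
    subst e1
    have e2 := hf' v h1.2.2.1 h1.1 h1'.1 l3
    subst e2
    have hw : G.degree w ≤ q + 3 := h1.2.1 ▸ h1.2.2.1
    have e3 := hf' w hw (hM.adj _ _ h4).symm (hM'.adj _ _ h4').symm l4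
    subst e3
    refine ⟨rfl, fun hag => eq_of_agree hag ?_⟩
    have a1 := hM.toOriented.selection_eq hM'.toOriented (he u) hM.subset_neighborFinset
      hM'.subset_neighborFinset h3 h3' l2
    have a2 := hM.toOriented.selection_eq hM'.toOriented (he x) hM.subset_neighborFinset
      hM'.subset_neighborFinset h4 h4' l5
    intro a ha
    simp only [Finset.mem_insert, Finset.mem_singleton] at ha
    rcases ha with rfl | rfl <;> assumption

/-- The common end `w` is not reset, so the selections of `v` and `x` are recovered from it across
the two bad edges. Only the pair of `u`, the location of the edges and the incidences are recorded;
the repeated `x` in the table is padding. -/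
theorem encodedBy_event3 (hc : IsProper G c) {e : V → V → Fin n}
    (he : ∀ u, Set.InjOn (e u) (G.neighborFinset u)) (n0 : Fin n) :
    EncodedBy (fun M R => Intermediate G c d N u M ∧ R ∈ event3 G c d M u)
      ((Fin n × Fin n) × (Bool × Fin n × Fin n) × Fin n × (Fin 5 → Fin 5 → Bool)) := by
  have he' : ∀ u {a b}, G.Adj u a → G.Adj u b → e u a = e u b → a = b := by
    intro u a b ha hb hab
    exact he u (by simpa using ha) (by simpa using hb) hab
  refine ⟨fun M R l => Intermediate G c d N u M ∧ ∃ v w x,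
    Bad G c d M v w ∧ Bad G c d M w x ∧ (G.Adj v u ∨ G.Adj w u) ∧ R = {u, v, x} ∧
    l = (pairCode (e u) (M u) n0, edgeCode G e u v w, e w x, incidence M ![u, v, w, x, x]), ?_, ?_⟩
  · rintro M R ⟨hM, v, w, x, h1, h2, -, h4, h5⟩
    exact ⟨_, hM, v, w, x, h1, h2, h4, h5, rfl⟩
  · rintro M R M' R' l ⟨hM, v, w, x, h1, h2, h3, rfl, rfl⟩
      ⟨hM', v', w', x', h1', h2', h3', rfl, hl⟩
    simp only [Prod.mk.injEq] at hl
    obtain ⟨l1, l2, l3, l4⟩ := hl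
    obtain ⟨rfl, rfl⟩ := edgeCode_inj he h1.adj h1'.adj h3 h3' l2
    have e2 := he' w h2.adj h2'.adj l3
    subst e2
    refine ⟨rfl, fun hag => eq_of_agree hag ?_⟩
    have a1 := hM.selection_eq hM' (he u) hM.subset_neighborFinset hM'.subset_neighborFinset l1
    have hw : M w = M' w := hag w (by
      simp [(hM.ne_of_bad h1).2.symm, h1.adj.ne', h2.adj.ne])
    have hU : ∀ j, Uminus G d M (![u, v, w, x, x] j) = Uminus G d M' (![u, v, w, x, x] j) := by
      intro j
      refine Uminus_eq_of_agree hag fun a ha => ?_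
      simp only [Finset.mem_insert, Finset.mem_singleton] at ha
      rcases ha with rfl | rfl | rfl
      exacts [mem_iff_of_incidence_eq l4 0 j, mem_iff_of_incidence_eq l4 1 j,
        mem_iff_of_incidence_eq l4 3 j]
    have a2 := h1.selection_eq hc hM.toOriented hM'.toOriented h1' hw (hU 1) (hU 2)
    have a3 := h2.symm.selection_eq hc hM.toOriented hM'.toOriented h2'.symm hw (hU 3) (hU 2)
    intro a ha
    simp only [Finset.mem_insert, Finset.mem_singleton] at ha
    rcases ha with rfl | rfl | rfl <;> assumption

/-- The pair of `w` contains the known vertex `x`, so one code gives it, and then `v` follows from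
`w` across `vw`. Since `x` is not reset, `y` follows from `x`. The first Boolean tells which of the
two bad edges is near `u`; the other is reached across `wx`. -/
theorem encodedBy_event4 (hc : IsProper G c) {e : V → V → Fin n}
    (he : ∀ u, Set.InjOn (e u) (G.neighborFinset u)) (n0 : Fin n) :
    EncodedBy (fun M R => Intermediate G c d N u M ∧ R ∈ event4 G c d M u)
      ((Fin n × Fin n) × (Bool × (Bool × Fin n × Fin n) × Fin n × Fin n) × Fin n ×
        (Fin 5 → Fin 5 → Bool)) := by
  have he' : ∀ u {a b}, G.Adj u a → G.Adj u b → e u a = e u b → a = b := by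
    intro u a b ha hb hab
    exact he u (by simpa using ha) (by simpa using hb) hab
  refine ⟨fun M R l => Intermediate G c d N u M ∧ ∃ v w x y,
    Bad G c d M v w ∧ Bad G c d M x y ∧ v ≠ x ∧ w ≠ x ∧
    (G.Adj v u ∨ G.Adj w u ∨ G.Adj x u ∨ G.Adj y u) ∧ x ∈ M w ∧ R = {u, v, w, y} ∧
    l = (pairCode (e u) (M u) n0,
      (if G.Adj v u ∨ G.Adj w u then (true, edgeCode G e u v w, e w x, e x y)
        else (false, edgeCode G e u x y, e x w, e w v)),
      otherCode (e w) (M w) x, incidence M ![u, v, w, x, y]), ?_, ?_⟩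
  · rintro M R ⟨hM, v, w, x, y, h1, h2, h3, -, h4, -, h5, h6, h7⟩
    exact ⟨_, hM, v, w, x, y, h1, h2, h3, h4, h5, h6, h7, rfl⟩
  · rintro M R M' R' l ⟨hM, v, w, x, y, h1, h2, h3, h4, h5, h6, rfl, rfl⟩
      ⟨hM', v', w', x', y', h1', h2', h3', h4', h5', h6', rfl, hl⟩
    simp only [Prod.mk.injEq] at hl
    obtain ⟨l1, l2, l3, l4⟩ := hl
    obtain ⟨rfl, rfl, rfl, rfl⟩ : v = v' ∧ w = w' ∧ x = x' ∧ y = y' := by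
      by_cases p1 : G.Adj v u ∨ G.Adj w u <;> by_cases p2 : G.Adj v' u ∨ G.Adj w' u
      · rw [if_pos p1, if_pos p2] at l2
        simp only [Prod.mk.injEq, true_and] at l2
        obtain ⟨rfl, rfl⟩ := edgeCode_inj he h1.adj h1'.adj p1 p2 l2.1
        have := he' w (hM.adj _ _ h6) (hM'.adj _ _ h6') l2.2.1
        subst this
        exact ⟨rfl, rfl, rfl, he' x h2.adj h2'.adj l2.2.2⟩
      · rw [if_pos p1, if_neg p2] at l2; simp at l2
      · rw [if_neg p1, if_pos p2] at l2; simp at l2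
      · rw [if_neg p1, if_neg p2] at l2
        simp only [Prod.mk.injEq, true_and] at l2
        obtain ⟨rfl, rfl⟩ := edgeCode_inj he h2.adj h2'.adj (by tauto) (by tauto) l2.1
        have := he' x (hM.adj _ _ h6).symm (hM'.adj _ _ h6').symm l2.2.1
        subst this
        exact ⟨he' w h1.adj.symm h1'.adj.symm l2.2.2, rfl, rfl, rfl⟩
    refine ⟨rfl, fun hag => eq_of_agree hag ?_⟩
    have a1 := hM.selection_eq hM' (he u) hM.subset_neighborFinset hM'.subset_neighborFinset l1
    have a2 := hM.toOriented.selection_eq hM'.toOriented (he w) hM.subset_neighborFinset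
      hM'.subset_neighborFinset h6 h6' l3
    have hx : M x = M' x := hag x (by
      simp [(hM.ne_of_bad h2).1.symm, h3.symm, h4.symm, h2.adj.ne])
    have hU : ∀ j, Uminus G d M (![u, v, w, x, y] j) = Uminus G d M' (![u, v, w, x, y] j) := by
      intro j
      refine Uminus_eq_of_agree hag fun a ha => ?_
      simp only [Finset.mem_insert, Finset.mem_singleton] at ha
      rcases ha with rfl | rfl | rfl | rfl
      exacts [mem_iff_of_incidence_eq l4 0 j, mem_iff_of_incidence_eq l4 1 j,
        mem_iff_of_incidence_eq l4 2 j, mem_iff_of_incidence_eq l4 4 j]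
    have a3 := h1.selection_eq hc hM.toOriented hM'.toOriented h1' a2 (hU 1) (hU 2)
    have a4 := h2.symm.selection_eq hc hM.toOriented hM'.toOriented h2'.symm hx (hU 4) (hU 3)
    intro a ha
    simp only [Finset.mem_insert, Finset.mem_singleton] at ha
    rcases ha with rfl | rfl | rfl | rfl <;> assumption

/-- The pairs of `w` and `x` share the known vertex `z`, so one further code gives each. The
selections of `v` and `y` are then recovered across the bad edges. -/
theorem encodedBy_event5 (hc : IsProper G c) {e : V → V → Fin n}
    (he : ∀ u, Set.InjOn (e u) (G.neighborFinset u)) (n0 : Fin n) :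
    EncodedBy (fun M R => Intermediate G c d N u M ∧ R ∈ event5 G c d M u)
      ((Fin n × Fin n) × (Bool × Fin n × Fin n) × (Fin n × Fin n × Fin n) × (Fin n × Fin n) ×
        (Fin 5 → Fin 5 → Bool)) := by
  have he' : ∀ u {a b}, G.Adj u a → G.Adj u b → e u a = e u b → a = b := by
    intro u a b ha hb hab
    exact he u (by simpa using ha) (by simpa using hb) hab
  refine ⟨fun M R l => Intermediate G c d N u M ∧ ∃ v w x y z,
    Bad G c d M v w ∧ Bad G c d M x y ∧ (G.Adj v u ∨ G.Adj w u) ∧ z ∈ M w ∧ z ∈ M x ∧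
    R = {u, v, w, x, y} ∧
    l = (pairCode (e u) (M u) n0, edgeCode G e u v w, (e w z, e z x, e x y),
      (otherCode (e w) (M w) z, otherCode (e x) (M x) z), incidence M ![u, v, w, x, y]), ?_, ?_⟩
  · rintro M R ⟨hM, v, w, x, y, z, h1, h2, -, -, -, -, h3, -, -, -, -, h4, h5, h6⟩
    exact ⟨_, hM, v, w, x, y, z, h1, h2, h3, (mem_Uminus.1 h4).2, (mem_Uminus.1 h5).2, h6, rfl⟩
  · rintro M R M' R' l ⟨hM, v, w, x, y, z, h1, h2, h3, h4, h5, rfl, rfl⟩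
      ⟨hM', v', w', x', y', z', h1', h2', h3', h4', h5', rfl, hl⟩
    simp only [Prod.mk.injEq] at hl
    obtain ⟨l1, l2, ⟨l3, l4, l5⟩, ⟨l6, l7⟩, l8⟩ := hl
    obtain ⟨rfl, rfl⟩ := edgeCode_inj he h1.adj h1'.adj h3 h3' l2
    have := he' w (hM.adj _ _ h4) (hM'.adj _ _ h4') l3
    subst this
    have := he' z (hM.adj _ _ h5).symm (hM'.adj _ _ h5').symm l4
    subst this
    have := he' x h2.adj h2'.adj l5
    subst this
    refine ⟨rfl, fun hag => eq_of_agree hag ?_⟩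
    have a1 := hM.selection_eq hM' (he u) hM.subset_neighborFinset hM'.subset_neighborFinset l1
    have a2 := hM.toOriented.selection_eq hM'.toOriented (he w) hM.subset_neighborFinset
      hM'.subset_neighborFinset h4 h4' l6
    have a3 := hM.toOriented.selection_eq hM'.toOriented (he x) hM.subset_neighborFinset
      hM'.subset_neighborFinset h5 h5' l7
    have hU : ∀ j, Uminus G d M (![u, v, w, x, y] j) = Uminus G d M' (![u, v, w, x, y] j) := by
      intro j
      refine Uminus_eq_of_agree hag fun a ha => ?_
      simp only [Finset.mem_insert, Finset.mem_singleton] at ha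
      rcases ha with rfl | rfl | rfl | rfl | rfl
      exacts [mem_iff_of_incidence_eq l8 0 j, mem_iff_of_incidence_eq l8 1 j,
        mem_iff_of_incidence_eq l8 2 j, mem_iff_of_incidence_eq l8 3 j,
        mem_iff_of_incidence_eq l8 4 j]
    have a4 := h1.selection_eq hc hM.toOriented hM'.toOriented h1' a2 (hU 1) (hU 2)
    have a5 := h2.symm.selection_eq hc hM.toOriented hM'.toOriented h2'.symm a3 (hU 4) (hU 3)
    intro a ha
    simp only [Finset.mem_insert, Finset.mem_singleton] at ha
    rcases ha with rfl | rfl | rfl | rfl | rfl <;> assumption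

end Graph

/-! ### Validity after resets, and the weight of one handled event. -/

section Graph

open scoped Classical

variable {V : Type*} [Fintype V] {G : SimpleGraph V} [DecidableRel G.Adj]
  {c : Sym2 V → ℕ} {d n : ℕ} {N : V → Finset V} {U M M' : V → Finset V} {u v w x : V}

/-- If `y` were in the second pair only, the colour of `uy` would be unselected at `u`, hence at
`x`, under the first pair. Changing the pair of `u` affects the selected edges at `x` only through
the edge `xu`, and `hx` prevents that edge from becoming selected. So the colour is unselected at
`x`, hence at `u`, under the second pair too, although `uy` is selected. -/
theorem bad_pair_subset (hc : IsProper G c) (hU : U u = ∅) {v' w' : V}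
    (hv : G.Adj u v) (hw : G.Adj u w) (hv' : G.Adj u v') (hw' : G.Adj u w')
    (hvm : v' ∉ Uminus G d U u) (hwm : w' ∉ Uminus G d U u)
    (hb : Bad G c d (assign U u v w) u x) (hb' : Bad G c d (assign U u v' w') u x)
    (hx : x = v' ∨ x = w' → x = v ∨ x = w) : ∀ y, y = v' ∨ y = w' → y = v ∨ y = w := by
  have hux : x ≠ u := hb.adj.ne'
  have hmem : ∀ {v w y : V}, y ∈ assign U u v w u ↔ y = v ∨ y = w := by
    intro v w y; simp [assign]
  have hne : ∀ {v w a : V}, a ≠ u → assign U u v w a = U a := fun ha => by simp [assign, ha]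
  have hUm : ∀ {v w : V}, G.Adj u v → G.Adj u w → ∀ y,
      y ∈ Uminus G d (assign U u v w) u ↔ y ∈ Uminus G d U u := by
    intro v w h1 h2 y
    rw [mem_Uminus, mem_Uminus]
    by_cases hy : y = u
    · subst hy
      rw [hmem, hU]
      simp [h1.ne, h2.ne]
    · rw [hne hy]
  intro y hy
  by_contra hcon
  have huy : G.Adj u y := by rcases hy with rfl | rfl <;> assumption
  have hyU : y ∉ Uminus G d U u := by rcases hy with rfl | rfl <;> assumption
  have h1 : c s(u, y) ∈ unselectedColours G c d (assign U u v w) u := by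
    refine ⟨y, huy, ?_, rfl⟩
    rw [Finset.mem_union, hmem, hUm hv hw]
    tauto
  rw [hb.2.2] at h1
  have h2 : c s(u, y) ∈ unselectedColours G c d (assign U u v' w') x := by
    obtain ⟨z, hz, hz', hz''⟩ := h1
    refine ⟨z, hz, fun hcon => hz' ?_, hz''⟩
    rw [Finset.mem_union, hne hux, mem_Uminus] at hcon ⊢
    refine hcon.imp_right fun h => ⟨h.1, ?_⟩
    by_cases hzu : z = u
    · subst hzu
      rw [hmem] at h ⊢
      exact hx h.2
    · rw [hne hzu] at h ⊢
      exact h.2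
  rw [← hb'.2.2] at h2
  obtain ⟨z, hz, hz', hz''⟩ := h2
  by_cases hzy : z = y
  · subst hzy
    exact hz' (Finset.mem_union_left _ (hmem.2 hy))
  · exact hc u z y hz huy hzy hz''

set_option linter.unusedSectionVars false in
theorem mem_reset {R : Finset V} {a : V} : reset M R a = ∅ ↔ a ∈ R ∨ M a = ∅ := by
  unfold reset
  split_ifs with h <;> simp [h]

theorem Intermediate.valid_update (hM : Intermediate G c d N u M) :
    Valid G d N (Function.update M u ∅) where
  toOriented := hM.toOriented.mono fun a => by
    by_cases ha : a = u
    · subst ha; simp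
    · simp [ha]
  indegree := hM.indegree

/-- Only the choice for `u` can have overloaded a vertex, so any reset that includes `u` restores
validity. -/
theorem Intermediate.valid_reset (hM : Intermediate G c d N u M) {R : Finset V} (hu : u ∈ R) :
    Valid G d N (reset M R) :=
  hM.valid_update.mono fun a => by
    by_cases ha : a ∈ R
    · left; simp [reset, ha]
    · right
      have : a ≠ u := by rintro rfl; exact ha hu
      simp [reset, ha, this]

theorem Intermediate.valid (hM : Intermediate G c d N u M)
    (h : ¬ (event1 G d M u).Nonempty) : Valid G d N M where
  toOriented := hM.toOriented
  indegree v := by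
    by_contra hcon
    push Not at hcon
    have hv := hM.mem_of_card_Uminus hcon
    exact h ⟨_, v, hM.adj _ _ hv, le_antisymm hM.card_Uminus_le hcon, rfl⟩

theorem Intermediate.event1_facts (hM : Intermediate G c d N u M) {R : Finset V}
    (hR : R ∈ event1 G d M u) : u ∈ R ∧ (∀ a ∈ R, M a ≠ ∅) ∧ R.card = q + 1 := by
  obtain ⟨v, h1, h2, rfl⟩ := hR
  exact ⟨hM.mem_Uminus.2 (hM.mem_of_card_Uminus (by omega)),
    fun a ha => Finset.ne_empty_of_mem (mem_Uminus.1 ha).2, h2⟩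

theorem Intermediate.event2_facts (hM : Intermediate G c d N u M) {R : Finset V}
    (hR : R ∈ event2 G d M u) : u ∈ R ∧ (∀ a ∈ R, M a ≠ ∅) ∧ R.card = 2 := by
  obtain ⟨v, w, x, h1, h2, h3, h4, h5, h6, rfl⟩ := hR
  refine ⟨by simp, ?_, Finset.card_pair h2.symm⟩
  intro a ha
  simp only [Finset.mem_insert, Finset.mem_singleton] at ha
  rcases ha with rfl | rfl
  exacts [hM.nonempty, Finset.ne_empty_of_mem (mem_Uminus.1 h6).2]

theorem Intermediate.event3_facts (hM : Intermediate G c d N u M) {R : Finset V}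
    (hR : R ∈ event3 G c d M u) : u ∈ R ∧ (∀ a ∈ R, M a ≠ ∅) ∧ R.card = 3 := by
  obtain ⟨v, w, x, h1, h2, h3, h4, rfl⟩ := hR
  refine ⟨by simp, ?_, ?_⟩
  · intro a ha
    simp only [Finset.mem_insert, Finset.mem_singleton] at ha
    rcases ha with rfl | rfl | rfl
    exacts [hM.nonempty, h1.left_nonempty, h2.symm.left_nonempty]
  · have := hM.ne_of_bad h1
    have := hM.ne_of_bad h2
    rw [Finset.card_insert_of_notMem, Finset.card_pair h3]
    simp_all

theorem Intermediate.event4_facts (hM : Intermediate G c d N u M) {R : Finset V}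
    (hR : R ∈ event4 G c d M u) : u ∈ R ∧ (∀ a ∈ R, M a ≠ ∅) ∧ R.card = 4 := by
  obtain ⟨v, w, x, y, h1, h2, h3, h4, h5, h6, -, -, rfl⟩ := hR
  refine ⟨by simp, ?_, ?_⟩
  · intro a ha
    simp only [Finset.mem_insert, Finset.mem_singleton] at ha
    rcases ha with rfl | rfl | rfl | rfl
    exacts [hM.nonempty, h1.left_nonempty, h1.symm.left_nonempty, h2.symm.left_nonempty]
  · have a1 := hM.ne_of_bad h1
    have a2 := hM.ne_of_bad h2
    have a3 := h1.adj.ne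
    rw [Finset.card_insert_of_notMem (by simp [a1.1, a1.2, a2.2]),
      Finset.card_insert_of_notMem (by simp [a3, h4]), Finset.card_pair h6]

theorem Intermediate.event5_facts (hM : Intermediate G c d N u M) {R : Finset V}
    (hR : R ∈ event5 G c d M u) : u ∈ R ∧ (∀ a ∈ R, M a ≠ ∅) ∧ R.card = 5 := by
  obtain ⟨v, w, x, y, z, h1, h2, h3, h4, h5, h6, -, -, -, -, -, -, -, rfl⟩ := hR
  refine ⟨by simp, ?_, ?_⟩
  · intro a ha
    simp only [Finset.mem_insert, Finset.mem_singleton] at ha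
    rcases ha with rfl | rfl | rfl | rfl | rfl
    exacts [hM.nonempty, h1.left_nonempty, h1.symm.left_nonempty, h2.left_nonempty,
      h2.symm.left_nonempty]
  · have a1 := hM.ne_of_bad h1
    have a2 := hM.ne_of_bad h2
    have a3 := h1.adj.ne
    have a4 := h2.adj.ne
    rw [Finset.card_insert_of_notMem (by simp [a1.1, a1.2, a2.1, a2.2]),
      Finset.card_insert_of_notMem (by simp [a3, h3, h4]),
      Finset.card_insert_of_notMem (by simp [h5, h6]), Finset.card_pair a4]

/-- No vertex of `R` was pending, so the exponent of `x` in the potential grows by exactly `R.card`.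
-/
theorem card_pending_reset (hM : Oriented G d N M) {R : Finset V} (hR : ∀ a ∈ R, M a ≠ ∅) :
    pending G d (reset M R) = pending G d M ∪ R ∧
      (pending G d (reset M R)).card = (pending G d M).card + R.card := by
  have h : pending G d (reset M R) = pending G d M ∪ R := by
    ext a
    rw [Finset.mem_union, mem_pending, mem_pending, mem_reset]
    have : a ∈ R → a ∈ big G d := fun ha => by
      by_contra hcon
      exact hR a ha (hM.eq_empty a hcon)
    tauto
  refine ⟨h, ?_⟩
  rw [h, Finset.card_union_of_disjoint]
  rw [Finset.disjoint_left]
  intro a ha ha'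
  exact hR a ha' (mem_pending.1 ha).2

theorem mem_handlings {R : Finset V} (h : R ∈ handlings G c d M u) :
    R ∈ event1 G d M u ∨ R ∈ event2 G d M u ∨ R ∈ event3 G c d M u ∨ R ∈ event4 G c d M u ∨
      R ∈ event5 G c d M u := by
  unfold handlings at h
  split_ifs at h <;> tauto

theorem not_event1_nonempty (h : ¬ (handlings G c d M u).Nonempty) :
    ¬ (event1 G d M u).Nonempty := by
  intro h'
  rw [handlings, if_pos h'] at h
  exact h h'

variable {ρ : (V → Finset V) → V → Finset V} {P : Finset V}

variable (G d N P) in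
/-- The valid states in which `P` is the set of the vertices still to be treated. -/
noncomputable def validStates : Finset (V → Finset V) :=
  Finset.univ.filter fun U => Valid G d N U ∧ pending G d U = P

theorem mem_validStates : U ∈ validStates G d N P ↔ Valid G d N U ∧ pending G d U = P := by
  simp [validStates]

variable {S : Finset (V → Finset V)} {b : (V → Finset V) → ℝ} {K : ℕ → ℝ}

/-- On the states with a common label the reset set is constant and the reset is injective, since
the label restores what was lost. Each label class thus embeds into the valid states with one fixed
pending set, and contributes at most one bound `K (P.card + k)`. -/
theorem sum_reset_le {E : (V → Finset V) → Finset V → Prop} {L : Type} [Fintype L] {k : ℕ}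
    (hE : EncodedBy E L) {ρ : (V → Finset V) → Finset V}
    (hS : ∀ M ∈ S, Oriented G d N M ∧ Valid G d N (reset M (ρ M)) ∧ E M (ρ M) ∧
      (∀ a ∈ ρ M, M a ≠ ∅) ∧ (ρ M).card = k)
    (hP : ∀ M ∈ S, pending G d M = P) (hb : ∀ U, 0 ≤ b U) (hK : ∀ i, 0 ≤ K i)
    (hbK : ∀ Q, ∑ U ∈ validStates G d N Q, b U ≤
      K Q.card) :
    ∑ M ∈ S, b (reset M (ρ M)) ≤ Fintype.card L * K (P.card + k) := by
  obtain ⟨code, h1, h2⟩ := hE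
  rcases S.eq_empty_or_nonempty with rfl | ⟨M0, hM0⟩
  · simpa using mul_nonneg (Nat.cast_nonneg _) (hK _)
  obtain ⟨l0, -⟩ := h1 M0 _ (hS M0 hM0).2.2.1
  have : ∀ M, ∃ l, M ∈ S → code M (ρ M) l := by
    intro M
    by_cases hM : M ∈ S
    · obtain ⟨l, hl⟩ := h1 M _ (hS M hM).2.2.1
      exact ⟨l, fun _ => hl⟩
    · exact ⟨l0, fun h => absurd h hM⟩
  choose lab hlab using this
  rw [← Finset.sum_fiberwise S lab]
  have : (Fintype.card L : ℝ) * K (P.card + k) = ∑ _l : L, K (P.card + k) := by simp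
  rw [this]
  refine Finset.sum_le_sum fun l _ => ?_
  rcases (S.filter fun M => lab M = l).eq_empty_or_nonempty with he | ⟨M1, hM1⟩
  · rw [he]; simpa using hK _
  rw [Finset.mem_filter] at hM1
  obtain ⟨hM1, hl1⟩ := hM1
  obtain ⟨o1, -, -, r1, k1⟩ := hS M1 hM1
  have hp := card_pending_reset o1 r1
  rw [hP M1 hM1, k1] at hp
  rw [← hp.2, hp.1]
  refine le_trans ?_ (hbK _)
  rw [← Finset.sum_image (f := b) (g := fun M => reset M (ρ M))]
  · refine Finset.sum_le_sum_of_subset_of_nonneg ?_ fun _ _ _ => hb _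
    intro U hU
    obtain ⟨M, hM, rfl⟩ := Finset.mem_image.1 hU
    rw [Finset.mem_filter] at hM
    obtain ⟨hM, hl⟩ := hM
    obtain ⟨o2, v2, -, r2, -⟩ := hS M hM
    rw [mem_validStates]
    refine ⟨v2, ?_⟩
    rw [(card_pending_reset o2 r2).1, hP M hM]
    have c1 := hlab M1 hM1
    have c2 := hlab M hM
    rw [hl1] at c1
    rw [hl] at c2
    rw [(h2 _ _ _ _ _ c1 c2).1]
  · intro M hM M' hM' heq
    simp only [Finset.coe_filter, Set.mem_ofPred_eq] at hM hM'
    have c1 := hlab M hM.1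
    have c2 := hlab M' hM'.1
    rw [hM.2] at c1
    rw [hM'.2] at c2
    obtain ⟨hR, hdec⟩ := h2 _ _ _ _ _ c1 c2
    refine hdec fun a ha => ?_
    have := congrFun heq a
    simpa [reset, ha, ← hR] using this

theorem sum_handle_le (hc : IsProper G c) (hρ : IsRule G c d ρ)
    (hn : ∀ u, G.degree u ≤ n) (hN : ∀ u ∈ big G d, (N u).card ≤ d) (hn0 : 0 < n) (hd0 : 0 < d)
    (hS : ∀ M ∈ S, Intermediate G c d N u M)
    (hP : ∀ M ∈ S, pending G d M = P) (hb : ∀ U, 0 ≤ b U) (hK : ∀ i, 0 ≤ K i)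
    (hbK : ∀ Q, ∑ U ∈ validStates G d N Q, b U ≤
      K Q.card) :
    ∑ M ∈ S, b (handle G c d ρ M u) ≤ K P.card +
      ((d ^ 2 * (n * d).choose q : ℕ) * K (P.card + (q + 1)) +
      ((256 * n ^ 3 : ℕ) * K (P.card + 2) +
      ((2 ^ 26 * n ^ 5 : ℕ) * K (P.card + 3) +
      ((2 ^ 27 * n ^ 7 : ℕ) * K (P.card + 4) +
      (2 ^ 26 * n ^ 9 : ℕ) * K (P.card + 5))))) := by
  obtain ⟨e, he⟩ := exists_code hn0 (fun u => G.neighborFinset u) (fun u => by simpa using hn u)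
  obtain ⟨f, hf⟩ := exists_code hd0 (fun u => if u ∈ big G d then N u else ∅) (fun u => by
    by_cases hu : u ∈ big G d
    · simpa [hu] using hN u hu
    · simp [hu])
  obtain ⟨g, hg⟩ := exists_code (n := q + 3) (by omega)
    (fun u => if G.degree u ≤ q + 3 then G.neighborFinset u else ∅) (fun u => by
    by_cases hu : G.degree u ≤ q + 3
    · simp [hu]
    · simp [hu])
  have hf' : ∀ u ∈ big G d, Set.InjOn (f u) (N u) := fun u hu => by simpa [hu] using hf u
  have hg' : ∀ u, G.degree u ≤ q + 3 → Set.InjOn (g u) (G.neighborFinset u) :=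
    fun u hu => by have := hg u; rwa [if_pos hu] at this
  set H : (V → Finset V) → Prop := fun M => (handlings G c d M u).Nonempty with hH
  -- The reset set may fit several event types; counting it once for each is harmless because `b` is
  -- nonnegative.
  have split : ∀ M ∈ S, b (handle G c d ρ M u) ≤
      (if ¬ H M then b (reset M ∅) else 0) +
      ((if ρ M u ∈ event1 G d M u then b (reset M (ρ M u)) else 0) +
      ((if ρ M u ∈ event2 G d M u then b (reset M (ρ M u)) else 0) +
      ((if ρ M u ∈ event3 G c d M u then b (reset M (ρ M u)) else 0) +
      ((if ρ M u ∈ event4 G c d M u then b (reset M (ρ M u)) else 0) +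
      (if ρ M u ∈ event5 G c d M u then b (reset M (ρ M u)) else 0))))) := by
    intro M _
    have hnn : ∀ (p : Prop) [Decidable p] (U : V → Finset V), 0 ≤ if p then b U else 0 := by
      intro p _ U; split_ifs; exacts [hb U, le_rfl]
    have n1 := hnn (ρ M u ∈ event1 G d M u) (reset M (ρ M u))
    have n2 := hnn (ρ M u ∈ event2 G d M u) (reset M (ρ M u))
    have n3 := hnn (ρ M u ∈ event3 G c d M u) (reset M (ρ M u))
    have n4 := hnn (ρ M u ∈ event4 G c d M u) (reset M (ρ M u))
    have n5 := hnn (ρ M u ∈ event5 G c d M u) (reset M (ρ M u))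
    by_cases h : H M
    · rw [handle, if_pos h, if_neg (not_not.2 h), zero_add]
      rcases mem_handlings (hρ M u h) with h | h | h | h | h
      · rw [if_pos h]; linarith
      · rw [if_pos h]; linarith
      · rw [if_pos h]; linarith
      · rw [if_pos h]; linarith
      · rw [if_pos h]; linarith
    · rw [handle, if_neg h, if_pos h]
      have : reset M ∅ = M := by funext a; simp [reset]
      rw [this]; linarith
  have sub : ∀ {E : (V → Finset V) → Prop} [DecidablePred E], ∀ M ∈ S.filter E, Intermediate G c d N u M ∧ E M :=
    fun M hM => ⟨hS M (Finset.mem_filter.1 hM).1, (Finset.mem_filter.1 hM).2⟩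
  have subP : ∀ {E : (V → Finset V) → Prop} [DecidablePred E], ∀ M ∈ S.filter E, pending G d M = P :=
    fun M hM => hP M (Finset.mem_filter.1 hM).1
  have per : ∀ {ev : (V → Finset V) → Set (Finset V)} [DecidablePred fun M => ρ M u ∈ ev M]
      {L : Type} [Fintype L] {k m : ℕ},
      EncodedBy (fun M R => Intermediate G c d N u M ∧ R ∈ ev M) L →
      (∀ M, Intermediate G c d N u M → ∀ R ∈ ev M, u ∈ R ∧ (∀ a ∈ R, M a ≠ ∅) ∧ R.card = k) →
      Fintype.card L = m →
      ∑ M ∈ S with ρ M u ∈ ev M, b (reset M (ρ M u)) ≤ m * K (P.card + k) := by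
    intro ev _ L _ k m hE hfacts hm
    subst hm
    refine sum_reset_le (N := N) (k := k) hE (ρ := fun M => ρ M u) (fun M hM => ?_) subP hb hK hbK
    obtain ⟨h1, h2⟩ := sub M hM
    have := hfacts M h1 _ h2
    exact ⟨h1.toOriented, h1.valid_reset this.1, ⟨h1, h2⟩, this.2⟩
  refine (Finset.sum_le_sum split).trans ?_
  simp only [Finset.sum_add_distrib, ← Finset.sum_filter]
  -- The case without an event is treated as a reset of the empty set, with a single label.
  have e0 : EncodedBy (fun (M : V → Finset V) R => R = ∅) Unit :=
    ⟨fun M R _ => R = ∅, fun M R h => ⟨(), h⟩, fun M R M' R' _ h h' => ⟨h.trans h'.symm, fun hag =>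
      funext fun a => hag a (by simp [h])⟩⟩
  refine add_le_add ?_ (add_le_add ?_ (add_le_add ?_ (add_le_add ?_ (add_le_add ?_ ?_))))
  · have := sum_reset_le (S := S.filter fun M => ¬ H M) (N := N) (k := 0) e0 (ρ := fun _ => ∅)
      (fun M hM => by
        obtain ⟨h1, h2⟩ := sub M hM
        have h0 : reset M ∅ = M := by funext a; simp [reset]
        refine ⟨h1.toOriented, ?_, rfl, by simp, by simp⟩
        rw [h0]
        exact h1.valid (not_event1_nonempty h2))
      subP hb hK hbK
    simpa using this
  · exact per (encodedBy_event1 he hf') (fun M hM R hR => hM.event1_facts hR)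
      (by simp [Fintype.card_finset_len, sq])
  · exact per (encodedBy_event2 he hg') (fun M hM R hR => hM.event2_facts hR) (by
      simp only [Fintype.card_prod, Fintype.card_fin]; unfold q; ring)
  · exact per (encodedBy_event3 hc he ⟨0, hn0⟩) (fun M hM R hR => hM.event3_facts hR)
      (by simp; ring)
  · exact per (encodedBy_event4 hc he ⟨0, hn0⟩) (fun M hM R hR => hM.event4_facts hR)
      (by simp; ring)
  · exact per (encodedBy_event5 hc he ⟨0, hn0⟩) (fun M hM R hR => hM.event5_facts hR)
      (by simp; ring)

end Graph

/-! ### Expectations under discrete distributions. -/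

open scoped ENNReal

theorem tsum_bind_mul {α β : Type*} (p : PMF α) (k : α → PMF β) (f : β → ℝ≥0∞) :
    ∑' o, p.bind k o * f o = ∑' a, p a * ∑' o, k a o * f o := by
  simp_rw [PMF.bind_apply, ← ENNReal.tsum_mul_right, ← ENNReal.tsum_mul_left]
  rw [ENNReal.tsum_comm]
  simp_rw [mul_assoc]

theorem tsum_pure_mul {α : Type*} (a : α) (f : α → ℝ≥0∞) : ∑' o, PMF.pure a o * f o = f a := by
  classical
  rw [tsum_eq_single a]
  · simp
  · intro b hb; simp [hb]

theorem tsum_uniform_map_mul {α β : Type*} (s : Finset α) (hs : s.Nonempty) (g : α → β)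
    (f : β → ℝ≥0∞) :
    ∑' o, (PMF.uniformOfFinset s hs).map g o * f o = (s.card : ℝ≥0∞)⁻¹ * ∑ a ∈ s, f (g a) := by
  rw [PMF.map, tsum_bind_mul]
  simp_rw [Function.comp_apply, tsum_pure_mul]
  rw [tsum_eq_sum (s := s), Finset.mul_sum]
  · refine Finset.sum_congr rfl fun a ha => ?_
    rw [PMF.uniformOfFinset_apply_of_mem _ ha]
  · intro a ha
    rw [PMF.uniformOfFinset_apply_of_notMem _ ha, zero_mul]

/-! ### Supply of admissible pairs, and survival probabilities. -/

section Algorithm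

open scoped Classical

variable {V : Type*} [Fintype V] [LinearOrder V] {G : SimpleGraph V} [DecidableRel G.Adj]
  {c : Sym2 V → ℕ} {d n : ℕ} {N : V → Finset V} {ρ : (V → Finset V) → V → Finset V}
  {U : V → Finset V} {u : V}

set_option linter.unusedSectionVars false in
theorem choose_two_le_card_pairs (A : Finset V) :
    A.card.choose 2 ≤ (Finset.univ.filter fun p : V ×ₗ V =>
      (ofLex p).1 < (ofLex p).2 ∧ (ofLex p).1 ∈ A ∧ (ofLex p).2 ∈ A).card := by
  rw [← Finset.card_powersetCard]
  refine Finset.card_le_card_of_surjOn (fun p => {(ofLex p).1, (ofLex p).2}) ?_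
  intro s hs
  simp only [Finset.mem_coe, Finset.mem_powersetCard] at hs
  obtain ⟨hsA, hs⟩ := hs
  obtain ⟨a, b, hab, rfl⟩ := Finset.card_eq_two.1 hs
  have ha : a ∈ A := hsA (by simp)
  have hb : b ∈ A := hsA (by simp)
  rcases lt_or_gt_of_ne hab with h | h
  · exact ⟨toLex (a, b), by simp [h, ha, hb], by simp⟩
  · exact ⟨toLex (b, a), by simp [h, ha, hb], by simp [Finset.pair_comm]⟩

set_option linter.unusedSectionVars false in
theorem pair_eq_of_imp {p p' : V ×ₗ V} (hp : (ofLex p).1 < (ofLex p).2)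
    (hp' : (ofLex p').1 < (ofLex p').2)
    (h : ∀ a, (a = (ofLex p).1 ∨ a = (ofLex p).2) → (a = (ofLex p').1 ∨ a = (ofLex p').2)) :
    p = p' := by
  have h1 := (h (ofLex p).1) (Or.inl rfl)
  have h2 := (h (ofLex p).2) (Or.inr rfl)
  apply ofLex.injective
  rcases h1 with h1 | h1 <;> rcases h2 with h2 | h2
  · exact absurd hp (by rw [h1, h2]; exact lt_irrefl _)
  · exact Prod.ext h1 h2
  · rw [h1, h2] at hp; exact absurd hp hp'.asymm
  · exact absurd hp (by rw [h1, h2]; exact lt_irrefl _)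

/-- A state with a vertex to be treated leaves few pairs of its neighbours inadmissible: each of
them is blamed on a small neighbour, if it is a fragile edge, or on the big neighbour with which it
creates a bad edge. -/
theorem choose_two_le_card_admissiblePairs (hc : IsProper G c)
    (hN : ∀ u ∈ big G d, N u ⊆ G.neighborFinset u ∧ (N u).card = d) (hd : q + 3 < d)
    (hU : Valid G d N U) (hu : u ∈ pending G d U) :
    (d - q).choose 2 ≤ (admissiblePairs G c d N U u).card + G.degree u := by
  obtain ⟨hub, hue⟩ := mem_pending.1 hu
  set A := N u \ Uminus G d U u with hA
  have hadj : ∀ a ∈ A, G.Adj u a := fun a ha => by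
    simpa using (hN u hub).1 (Finset.mem_sdiff.1 ha).1
  have hAU : ∀ a ∈ A, a ∉ Uminus G d U u := fun a ha => (Finset.mem_sdiff.1 ha).2
  have hAN : ∀ a ∈ A, a ∈ N u := fun a ha => (Finset.mem_sdiff.1 ha).1
  have h1 : d - q ≤ A.card := by
    have := Finset.le_card_sdiff (Uminus G d U u) (N u)
    rw [(hN u hub).2, ← hA] at this
    have := hU.indegree u
    omega
  refine (Nat.choose_le_choose 2 h1).trans ((choose_two_le_card_pairs A).trans ?_)
  set T := Finset.univ.filter fun p : V ×ₗ V =>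
      (ofLex p).1 < (ofLex p).2 ∧ (ofLex p).1 ∈ A ∧ (ofLex p).2 ∈ A with hT
  have memT : ∀ p ∈ T, (ofLex p).1 < (ofLex p).2 ∧ (ofLex p).1 ∈ A ∧ (ofLex p).2 ∈ A :=
    fun p hp => by simpa [hT] using hp
  have h2 : (T \ admissiblePairs G c d N U u).card ≤ G.degree u := by
    rw [← SimpleGraph.card_neighborFinset_eq_degree]
    have key : ∀ p : V ×ₗ V, ∃ x, p ∈ T \ admissiblePairs G c d N U u → G.Adj u x ∧
        ((x = (ofLex p).1 ∧ Fragile G d x (ofLex p).2) ∨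
          Bad G c d (assign U u (ofLex p).1 (ofLex p).2) u x) := by
      intro p
      by_cases hp : p ∈ T \ admissiblePairs G c d N U u
      · obtain ⟨hpT, hpa⟩ := Finset.mem_sdiff.1 hp
        obtain ⟨m1, m2, m3⟩ := memT p hpT
        have : ¬ Admissible G c d N U u (ofLex p).1 (ofLex p).2 := by
          intro hcon
          exact hpa (by simp [admissiblePairs, m1, hcon])
        by_cases hf : Fragile G d (ofLex p).1 (ofLex p).2
        · exact ⟨_, fun _ => ⟨hadj _ m2, Or.inl ⟨rfl, hf⟩⟩⟩
        · have : ∃ x, Bad G c d (assign U u (ofLex p).1 (ofLex p).2) u x := by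
            by_contra hcon
            push Not at hcon
            exact this ⟨m1.ne, hAN _ m2, hAN _ m3, hAU _ m2, hAU _ m3, fun _ => hf, hcon⟩
          obtain ⟨x, hx⟩ := this
          exact ⟨x, fun _ => ⟨hx.adj, Or.inr hx⟩⟩
      · exact ⟨u, fun h => absurd h hp⟩
    choose F hF using key
    refine Finset.card_le_card_of_injOn F (fun p hp => by simpa using (hF p hp).1) ?_
    intro p hp p' hp' heq
    have t1 := memT p (Finset.mem_sdiff.1 hp).1
    have t2 := memT p' (Finset.mem_sdiff.1 hp').1
    have f1 := (hF p hp).2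
    have f2 := (hF p' hp').2
    rw [← heq] at f2
    have small : ∀ {a b}, Fragile G d a b → ¬ d ≤ G.degree a := by
      intro a b h
      have := h.2.2.1
      omega
    rcases f1 with ⟨e1, f1⟩ | f1 <;> rcases f2 with ⟨e2, f2⟩ | f2
    -- A second fragile edge at the same vertex would have an end that is big by the first edge and
    -- small by the second.
    · have e3 : (ofLex p).2 = (ofLex p').2 := by
        by_contra hne
        have h3 := f1.2.2.2 _ (Or.inl f2.1) f2.1.ne' (Ne.symm hne)
        have h4 := f2.2.1
        have h5 := f2.2.2.1
        omega
      exact ofLex.injective (Prod.ext (e1.symm.trans e2) e3)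
    · exact absurd (mem_big.1 f2.symm.left_mem_big) (small f1)
    · exact absurd (mem_big.1 f1.symm.left_mem_big) (small f2)
    · have s1 : ∀ {p p' : V ×ₗ V}, p ∈ T → p' ∈ T →
          Bad G c d (assign U u (ofLex p).1 (ofLex p).2) u (F p) →
          Bad G c d (assign U u (ofLex p').1 (ofLex p').2) u (F p) →
          (F p = (ofLex p').1 ∨ F p = (ofLex p').2 → F p = (ofLex p).1 ∨ F p = (ofLex p).2) →
          p' = p := by
        intro p p' hp hp' f1 f2 hx
        obtain ⟨m1, m2, m3⟩ := memT p hp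
        obtain ⟨m1', m2', m3'⟩ := memT p' hp'
        exact pair_eq_of_imp m1' m1 (bad_pair_subset hc hue (hadj _ m2) (hadj _ m3) (hadj _ m2')
          (hadj _ m3') (hAU _ m2') (hAU _ m3') f1 f2 hx)
      have hpT := (Finset.mem_sdiff.1 hp).1
      have hpT' := (Finset.mem_sdiff.1 hp').1
      -- The hypothesis of `bad_pair_subset` holds for the two pairs in at least one order, and
      -- inclusion between two-element sets is equality.
      by_cases hx : F p = (ofLex p').1 ∨ F p = (ofLex p').2 → F p = (ofLex p).1 ∨ F p = (ofLex p).2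
      · exact (s1 hpT hpT' f1 f2 hx).symm
      · have : p = p' := by
          rw [heq] at f1 f2 hx
          exact s1 hpT' hpT f2 f1 (by tauto)
        exact this
  have h3 : T.card ≤ (T \ admissiblePairs G c d N U u).card +
      (admissiblePairs G c d N U u).card := by
    have := Finset.le_card_sdiff (admissiblePairs G c d N U u) T
    omega
  omega

theorem card_firstPairs (h : numChoices d ≤ (admissiblePairs G c d N U u).card) :
    (firstPairs G c d N U u).card = numChoices d := by
  rw [firstPairs, List.toFinset_card_of_nodup]
  · simpa using h
  · exact (Finset.sort_nodup _ _).sublist (List.take_sublist _ _)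

theorem firstPairs_subset : firstPairs G c d N U u ⊆ admissiblePairs G c d N U u := by
  intro p hp
  rw [firstPairs, List.mem_toFinset] at hp
  simpa using List.mem_of_mem_take hp

variable (G c d N ρ) in
/-- The probability that the algorithm does not stop in at most `t` steps. -/
noncomputable def survival : ℕ → Option (V → Finset V) → ℝ≥0∞
  | 0, o => if ∃ U, o = some U ∧ pending G d U = ∅ then 0 else 1
  | t + 1, o => ∑' o', (o.elim (PMF.pure none) (step G c d N ρ)) o' * survival t o'

theorem survival_le_one (t : ℕ) (o : Option (V → Finset V)) : survival G c d N ρ t o ≤ 1 := by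
  induction t generalizing o with
  | zero => rw [survival]; split_ifs <;> simp
  | succ t ih =>
    rw [survival]
    refine (ENNReal.tsum_le_tsum fun o' => mul_le_mul_right (ih o') _).trans ?_
    simp_rw [mul_one]
    exact (PMF.tsum_coe _).le

/-- `run` appends a step at the end whereas `survival` splits off the first one. This interpolates
between them and gives, at `t = 0`, the link with `probStops`. -/
theorem tsum_run_mul_survival (k t : ℕ) :
    ∑' o, run G c d N ρ k o * survival G c d N ρ t o =
      survival G c d N ρ (k + t) (some fun _ => ∅) := by
  induction k generalizing t with
  | zero => rw [run, tsum_pure_mul, zero_add]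
  | succ k ih =>
    rw [run, tsum_bind_mul, show k + 1 + t = k + (t + 1) by ring, ← ih]
    rfl

theorem probStops_add_survival (t : ℕ) :
    probStops G c d N ρ t + survival G c d N ρ t (some fun _ => ∅) = 1 := by
  rw [← add_zero t, ← tsum_run_mul_survival t 0, probStops, PMF.toOuterMeasure_apply,
    ← ENNReal.tsum_add, ← PMF.tsum_coe (run G c d N ρ t)]
  refine tsum_congr fun o => ?_
  by_cases h : ∃ U, o = some U ∧ pending G d U = ∅
  · rw [survival, if_pos h, Set.indicator_of_mem (by exact h), mul_zero, add_zero,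
      add_zero]
  · rw [survival, if_neg h, Set.indicator_of_notMem (by exact h), mul_one, zero_add]

theorem survival_of_pending_eq_empty (h : pending G d U = ∅) (t : ℕ) :
    survival G c d N ρ t (some U) = 0 := by
  induction t with
  | zero => rw [survival, if_pos ⟨U, rfl, h⟩]
  | succ t ih =>
    rw [survival, Option.elim_some, step, dif_neg (by simp [h]), tsum_pure_mul, ih]

theorem survival_succ (h : (pending G d U).Nonempty) (hs : 0 < numChoices d)
    (h' : numChoices d ≤ (admissiblePairs G c d N U ((pending G d U).min' h)).card) (t : ℕ) :
    survival G c d N ρ (t + 1) (some U) = (numChoices d : ℝ≥0∞)⁻¹ *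
      ∑ p ∈ firstPairs G c d N U ((pending G d U).min' h),
        survival G c d N ρ t (some (treat G c d ρ U ((pending G d U).min' h) p)) := by
  have hcard := card_firstPairs h'
  have hne : (firstPairs G c d N U ((pending G d U).min' h)).Nonempty := by
    rw [← Finset.card_pos, hcard]; exact hs
  rw [survival, Option.elim_some, step, dif_pos h, dif_pos ⟨h', hne⟩, tsum_uniform_map_mul, hcard]

end Algorithm

/-! ### Geometric decay of the summed survival probabilities. -/

section Algorithm

open scoped Classical

variable {V : Type*} [Fintype V] [LinearOrder V] {G : SimpleGraph V} [DecidableRel G.Adj]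
  {c : Sym2 V → ℕ} {d n : ℕ} {N : V → Finset V} {ρ : (V → Finset V) → V → Finset V}
  {U : V → Finset V} {u : V} {b : (V → Finset V) → ℝ} {K : ℕ → ℝ} {P : Finset V}

theorem sum_treat_le (hc : IsProper G c) (hρ : IsRule G c d ρ)
    (hn : ∀ u, G.degree u ≤ n) (hN : ∀ u ∈ big G d, N u ⊆ G.neighborFinset u ∧ (N u).card = d)
    (hn0 : 0 < n) (hd0 : 0 < d) (hu : u ∈ P) (hb : ∀ U, 0 ≤ b U) (hK : ∀ i, 0 ≤ K i)
    (hbK : ∀ Q, ∑ U ∈ validStates G d N Q, b U ≤ K Q.card) :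
    ∑ U ∈ validStates G d N P, ∑ p ∈ firstPairs G c d N U u, b (treat G c d ρ U u p) ≤
      K (P.card - 1) +
      ((d ^ 2 * (n * d).choose q : ℕ) * K (P.card - 1 + (q + 1)) +
      ((256 * n ^ 3 : ℕ) * K (P.card - 1 + 2) +
      ((2 ^ 26 * n ^ 5 : ℕ) * K (P.card - 1 + 3) +
      ((2 ^ 27 * n ^ 7 : ℕ) * K (P.card - 1 + 4) +
      (2 ^ 26 * n ^ 9 : ℕ) * K (P.card - 1 + 5))))) := by
  rw [Finset.sum_sigma']
  set T := (validStates G d N P).sigma fun U => firstPairs G c d N U u with hT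
  have memT : ∀ a ∈ T, Valid G d N a.1 ∧ pending G d a.1 = P ∧
      (ofLex a.2).1 < (ofLex a.2).2 ∧
      Admissible G c d N a.1 u (ofLex a.2).1 (ofLex a.2).2 := by
    intro a ha
    rw [hT, Finset.mem_sigma, mem_validStates] at ha
    have := firstPairs_subset ha.2
    simp only [admissiblePairs, Finset.mem_filter, Finset.mem_univ, true_and] at this
    exact ⟨ha.1.1, ha.1.2, this.1, this.2⟩
  have hpu : ∀ a ∈ T, u ∈ pending G d a.1 := fun a ha => by rw [(memT a ha).2.1]; exact hu
  have hcard : (P.erase u).card = P.card - 1 := Finset.card_erase_of_mem hu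
  have hinj : Set.InjOn (fun a : (Σ _ : V → Finset V, V ×ₗ V) =>
      assign a.1 u (ofLex a.2).1 (ofLex a.2).2) T := by
    rintro ⟨U, p⟩ ha ⟨U', p'⟩ ha' heq
    obtain ⟨h1, h2⟩ := assign_inj (mem_pending.1 (hpu _ ha)).2 (mem_pending.1 (hpu _ ha')).2 heq
    have := pair_eq_of_imp (memT _ ha).2.2.1 (memT _ ha').2.2.1 fun a => (h2 a).1
    simp only at h1 this
    rw [h1, this]
  have := sum_handle_le (u := u) (P := P.erase u)
    (S := T.image fun a => assign a.1 u (ofLex a.2).1 (ofLex a.2).2)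
    hc hρ hn (fun u hu => (hN u hu).2.le) hn0 hd0 ?_ ?_ hb hK hbK
  · rw [Finset.sum_image hinj, hcard] at this
    exact this
  · intro M hM
    obtain ⟨a, ha, rfl⟩ := Finset.mem_image.1 hM
    exact (memT a ha).1.intermediate hN (hpu a ha) (memT a ha).2.2.2
  · intro M hM
    obtain ⟨a, ha, rfl⟩ := Finset.mem_image.1 hM
    ext v
    rw [← (memT a ha).2.1, Finset.mem_erase, mem_pending, mem_pending]
    by_cases hv : v = u
    · subst hv; simp [assign]
    · simp [assign, hv]

/-- With `K i = C * x ^ i * θ ^ t`, one step multiplies the bound by the left side of `H` and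
divides it by `numChoices d * x`, the `x` accounting for the vertex just treated. So `H` says that a
step costs at most a factor `θ`. -/
theorem sum_survival_le (hc : IsProper G c) (hρ : IsRule G c d ρ)
    (hn : ∀ u, G.degree u ≤ n) (hN : ∀ u ∈ big G d, N u ⊆ G.neighborFinset u ∧ (N u).card = d)
    (hn0 : 0 < n) (hd : q + 3 < d) (hs : 0 < numChoices d) (hnd : n ≤ 3 * d)
    {x θ : ℝ} (hx : 0 < x) (hx1 : x ≤ 1) (hθ : 0 ≤ θ)
    (H : 1 + ((d ^ 2 * (n * d).choose q : ℕ) * x ^ (q + 1) + ((256 * n ^ 3 : ℕ) * x ^ 2 +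
      ((2 ^ 26 * n ^ 5 : ℕ) * x ^ 3 + ((2 ^ 27 * n ^ 7 : ℕ) * x ^ 4 +
      (2 ^ 26 * n ^ 9 : ℕ) * x ^ 5)))) ≤ numChoices d * x * θ) :
    ∃ C : ℝ, 0 ≤ C ∧ ∀ t P, ∑ U ∈ validStates G d N P, (survival G c d N ρ t (some U)).toReal ≤
      C * x ^ P.card * θ ^ t := by
  -- At `t = 0` every probability is at most 1, and `x ^ P.card ≥ x ^ Fintype.card V` because `x ≤
  -- 1`.
  set C : ℝ := (Fintype.card (V → Finset V) : ℝ) * (x ^ Fintype.card V)⁻¹ with hC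
  have hC0 : 0 ≤ C := by positivity
  refine ⟨C, hC0, fun t => ?_⟩
  induction t with
  | zero =>
    intro P
    have h1 : ∑ U ∈ validStates G d N P, (survival G c d N ρ 0 (some U)).toReal ≤
        (Fintype.card (V → Finset V) : ℝ) := by
      refine (Finset.sum_le_sum fun U _ => ENNReal.toReal_mono ENNReal.one_ne_top
        (survival_le_one 0 _)).trans ?_
      simp only [ENNReal.toReal_one, Finset.sum_const, nsmul_eq_mul, mul_one]
      exact_mod_cast Finset.card_le_univ _
    refine h1.trans ?_
    have h2 : x ^ Fintype.card V ≤ x ^ P.card :=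
      pow_le_pow_of_le_one hx.le hx1 (Finset.card_le_univ P)
    rw [pow_zero, mul_one, hC, mul_assoc]
    refine le_mul_of_one_le_right (by positivity) ?_
    rw [inv_mul_eq_div, one_le_div (by positivity)]
    exact h2
  | succ t ih =>
    intro P
    rcases P.eq_empty_or_nonempty with rfl | hP
    · refine (Finset.sum_eq_zero fun U hU => ?_).trans_le (by positivity)
      rw [survival_of_pending_eq_empty (mem_validStates.1 hU).2, ENNReal.toReal_zero]
    · have hrec : ∀ U ∈ validStates G d N P, (survival G c d N ρ (t + 1) (some U)).toReal =
          (numChoices d : ℝ)⁻¹ * ∑ p ∈ firstPairs G c d N U (P.min' hP),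
            (survival G c d N ρ t (some (treat G c d ρ U (P.min' hP) p))).toReal := by
        intro U hU
        obtain ⟨h1, rfl⟩ := mem_validStates.1 hU
        have h2 := choose_two_le_card_admissiblePairs hc hN hd h1 (Finset.min'_mem _ hP)
        have h3 := hn ((pending G d U).min' hP)
        -- The inadmissible pairs number at most `G.degree u ≤ n ≤ 3 * d`, which is the `3 * d`
        -- subtracted in `numChoices`.
        rw [survival_succ hP hs (by unfold numChoices; omega), ENNReal.toReal_mul,
          ENNReal.toReal_sum]
        · simp
        · exact fun p _ => ne_top_of_le_ne_top ENNReal.one_ne_top (survival_le_one _ _)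
      rw [Finset.sum_congr rfl hrec, ← Finset.mul_sum]
      have h1 := sum_treat_le (b := fun U => (survival G c d N ρ t (some U)).toReal)
        (K := fun i => C * x ^ i * θ ^ t) hc hρ hn hN hn0 (by omega) (Finset.min'_mem P hP)
        (fun _ => ENNReal.toReal_nonneg) (fun i => by positivity) ih
      refine (mul_le_mul_of_nonneg_left h1 (by positivity)).trans ?_
      have hs' : (0 : ℝ) < numChoices d := by exact_mod_cast hs
      rw [inv_mul_le_iff₀ hs']
      have hpos : 0 < P.card := hP.card_pos
      obtain ⟨m, hm⟩ : ∃ m, P.card = m + 1 := ⟨P.card - 1, by omega⟩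
      rw [hm, Nat.add_sub_cancel]
      have h2 := mul_le_mul_of_nonneg_left H (show 0 ≤ C * x ^ m * θ ^ t by positivity)
      calc _ = C * x ^ m * θ ^ t * _ := by simp only [pow_add x m]; ring
        _ ≤ _ := h2
        _ = _ := by ring

theorem tendsto_probStops (hc : IsProper G c) (hρ : IsRule G c d ρ)
    (hn : ∀ u, G.degree u ≤ n) (hN : ∀ u ∈ big G d, N u ⊆ G.neighborFinset u ∧ (N u).card = d)
    (hn0 : 0 < n) (hd : q + 3 < d) (hs : 0 < numChoices d) (hnd : n ≤ 3 * d)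
    {x θ : ℝ} (hx : 0 < x) (hx1 : x ≤ 1) (hθ : 0 ≤ θ) (hθ1 : θ < 1)
    (H : 1 + ((d ^ 2 * (n * d).choose q : ℕ) * x ^ (q + 1) + ((256 * n ^ 3 : ℕ) * x ^ 2 +
      ((2 ^ 26 * n ^ 5 : ℕ) * x ^ 3 + ((2 ^ 27 * n ^ 7 : ℕ) * x ^ 4 +
      (2 ^ 26 * n ^ 9 : ℕ) * x ^ 5)))) ≤ numChoices d * x * θ) :
    Filter.Tendsto (fun t : ℕ => probStops G c d N ρ t) Filter.atTop (nhds 1) := by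
  obtain ⟨C, hC, h⟩ := sum_survival_le hc hρ hn hN hn0 hd hs hnd hx hx1 hθ H
  set U0 : V → Finset V := fun _ => ∅
  have hreal : Filter.Tendsto (fun t => (survival G c d N ρ t (some U0)).toReal) Filter.atTop
      (nhds 0) := by
    have h0 : Filter.Tendsto (fun t => C * x ^ (pending G d U0).card * θ ^ t) Filter.atTop
        (nhds 0) := by
      simpa using (tendsto_pow_atTop_nhds_zero_of_lt_one hθ hθ1).const_mul
        (C * x ^ (pending G d U0).card)
    refine squeeze_zero (fun _ => ENNReal.toReal_nonneg) (fun t => ?_) h0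
    refine le_trans ?_ (h t (pending G d U0))
    exact Finset.single_le_sum (f := fun U => (survival G c d N ρ t (some U)).toReal)
      (fun _ _ => ENNReal.toReal_nonneg) (mem_validStates.2 ⟨valid_empty, rfl⟩)
  have hfin : ∀ t, survival G c d N ρ t (some U0) ≠ ∞ := fun t =>
    ne_top_of_le_ne_top ENNReal.one_ne_top (survival_le_one t _)
  have hE : Filter.Tendsto (fun t => survival G c d N ρ t (some U0)) Filter.atTop (nhds 0) :=
    (ENNReal.tendsto_toReal_iff hfin ENNReal.zero_ne_top).1 (by simpa using hreal)
  have hp : ∀ t, probStops G c d N ρ t = 1 - survival G c d N ρ t (some U0) := fun t =>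
    ENNReal.eq_sub_of_add_eq (hfin t) (probStops_add_survival t)
  simp_rw [hp]
  simpa using ENNReal.Tendsto.sub (tendsto_const_nhds (x := (1 : ℝ≥0∞))) hE
    (Or.inl ENNReal.one_ne_top)

end Algorithm

/-! ### Numerical estimates. -/

section Numerics

variable {n x : ℝ}

/-- The powers of `s` cancel: `n * d` is about `4 * s` and `d ^ 2` about `2 * s`, leaving roughly `2
* 4 ^ 13 / 13! * 1.1 ^ 14`. This is not small for large degree, so it is the place where `q` must be
large enough. -/
theorem choose_mul_pow_le {n d : ℕ} {s : ℝ} (hs : 0 < s) (h1 : (n : ℝ) ≤ 2.005 * d)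
    (h2 : (d : ℝ) ^ 2 ≤ 2.008 * s) :
    ((d ^ 2 * (n * d).choose q : ℕ) : ℝ) * (11 / 10 / s) ^ (q + 1) ≤ 9 / 100 := by
  have h3 : (((n * d).choose 13 : ℕ) : ℝ) ≤ ((n * d : ℕ) : ℝ) ^ 13 / (Nat.factorial 13 : ℕ) :=
    Nat.choose_le_pow_div 13 (n * d)
  have h4 : ((n * d : ℕ) : ℝ) ≤ 2.005 * d ^ 2 := by
    push_cast
    nlinarith [Nat.cast_nonneg (α := ℝ) d]
  have h5 : ((n * d : ℕ) : ℝ) ≤ 2.005 * (2.008 * s) := h4.trans (by linarith)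
  have h6 : ((n * d : ℕ) : ℝ) ^ 13 ≤ (2.005 * (2.008 * s)) ^ 13 :=
    pow_le_pow_left₀ (Nat.cast_nonneg _) h5 13
  have h7 : ((d ^ 2 * (n * d).choose q : ℕ) : ℝ) ≤
      2.008 * s * ((2.005 * (2.008 * s)) ^ 13 / (Nat.factorial 13 : ℕ)) := by
    rw [Nat.cast_mul, Nat.cast_pow]
    refine mul_le_mul h2 (h3.trans ?_) (Nat.cast_nonneg _) (by positivity)
    gcongr
  refine (mul_le_mul_of_nonneg_right h7 (by positivity)).trans ?_
  have : 2.008 * s * ((2.005 * (2.008 * s)) ^ 13 / (Nat.factorial 13 : ℕ)) *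
      (11 / 10 / s) ^ (q + 1) =
      2.008 * ((2.005 * 2.008) ^ 13 / (Nat.factorial 13 : ℕ)) * (11 / 10) ^ 14 := by
    rw [q, div_pow, mul_pow, mul_pow, mul_pow]
    field_simp
    ring
  rw [this]
  norm_num [Nat.factorial]

/-- The expression is `a * (x * n ^ 2) ^ (k + 1) / n`: one missing factor `n` makes events 2 to 5
negligible. -/
theorem mul_pow_le_of_mul_sq_le {k : ℕ} {a : ℝ} (hn : 10 ^ 16 ≤ n) (hx : 0 ≤ x)
    (hxn : x * n ^ 2 ≤ 10) (ha : 0 ≤ a) (hak : a * 10 ^ (k + 1) ≤ 10 ^ 13) :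
    a * n ^ (2 * k + 1) * x ^ (k + 1) ≤ 1 / 1000 := by
  have hn0 : (0 : ℝ) < n := lt_of_lt_of_le (by norm_num) hn
  have h1 : (x * n ^ 2) ^ (k + 1) ≤ 10 ^ (k + 1) := pow_le_pow_left₀ (by positivity) hxn _
  have h2 : a * n ^ (2 * k + 1) * x ^ (k + 1) * n = a * (x * n ^ 2) ^ (k + 1) := by
    rw [mul_pow, ← pow_mul]; ring
  have h3 := mul_le_mul_of_nonneg_left h1 ha
  refine le_of_mul_le_mul_right ?_ hn0
  rw [h2]
  nlinarith

theorem sq_le_numChoices {d : ℕ} (hd : 10 ^ 10 ≤ d) :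
    (d : ℝ) ^ 2 ≤ 2.008 * (numChoices d : ℝ) := by
  have hd' : (10 : ℝ) ^ 10 ≤ d := by exact_mod_cast hd
  have h1 : ((d - q).choose 2 : ℝ) - 3 * d ≤ (numChoices d : ℝ) := by
    have : (d - q).choose 2 ≤ numChoices d + 3 * d := by unfold numChoices; omega
    have : (((d - q).choose 2 : ℕ) : ℝ) ≤ ((numChoices d + 3 * d : ℕ) : ℝ) := by exact_mod_cast this
    push_cast at this
    linarith
  rw [Nat.cast_choose_two, Nat.cast_sub (by unfold q; omega)] at h1
  have : ((q : ℕ) : ℝ) = 13 := by norm_num [q]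
  rw [this] at h1
  nlinarith

end Numerics

end AVD

theorem theorem3 :
    ∃ ε₀ : ℝ, 0 < ε₀ ∧ ε₀ ≤ 1 / 2 ∧ ∀ ε : ℝ, 0 < ε → ε < ε₀ →
      ∃ Δ₀ : ℕ, ∀ (V : Type*) [Fintype V] [LinearOrder V] (G : SimpleGraph V) [DecidableRel G.Adj]
        (Δ d : ℕ) (c : Sym2 V → ℕ) (N : V → Finset V) (ρ : (V → Finset V) → V → Finset V),
        G.maxDegree = Δ → Δ₀ ≤ Δ → d = AVD.threshold ε Δ →
        -- no isolated edge
        (∀ u v, G.Adj u v → ¬ (G.degree u = 1 ∧ G.degree v = 1)) →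
        -- the initial colouring
        AVD.IsProper G c → (G.edgeFinset.image c).card ≤ Δ + 2 → AVD.SmallEdgesSeparated G c d →
        -- the arbitrarily chosen sets of `d` neighbours of the big vertices
        (∀ u ∈ AVD.big G d, N u ⊆ G.neighborFinset u ∧ (N u).card = d) →
        -- the rule choosing the instance of a bad event to be handled
        AVD.IsRule G c d ρ →
        Filter.Tendsto (fun t : ℕ => AVD.probStops G c d N ρ t) Filter.atTop (nhds 1) := by
  -- Here `ε < 1 / 1000` gives `n ≤ 2.005 * d`, and `10 ^ 16` absorbs the constants up to `10 ^ 13`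
  -- of the label counts with a margin of `1000`.
  refine ⟨1 / 1000, by norm_num, by norm_num, fun ε hε hε' => ⟨10 ^ 16, ?_⟩⟩
  intro V _ _ G _ n d c N ρ hmax hn hd _ hc _ _ hN hρ
  have hn' : (10 : ℝ) ^ 16 ≤ n := by exact_mod_cast hn
  have hd1 : (1 / 2 - ε) * (n : ℝ) ≤ d := by rw [hd]; exact Nat.le_ceil _
  have hnd : (n : ℝ) ≤ 2.005 * d := by nlinarith
  have hd10 : 10 ^ 10 ≤ d := by
    have : (10 : ℝ) ^ 10 ≤ d := by linarith
    exact_mod_cast this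
  have hs := AVD.sq_le_numChoices hd10
  have hd' : (10 : ℝ) ^ 10 ≤ d := by exact_mod_cast hd10
  set s : ℝ := (AVD.numChoices d : ℝ)
  have hsn : (n : ℝ) ^ 2 ≤ 9 * s := by nlinarith
  have hs1 : 100 ≤ s := by nlinarith
  have hs0 : 0 < s := by linarith
  have hxn : 11 / 10 / s * (n : ℝ) ^ 2 ≤ 10 := by
    rw [div_mul_eq_mul_div, div_le_iff₀ hs0]; linarith
  -- With these values the right side of `H` is `1.1 * 0.996 = 1.0956`, and the left side is at most
  -- `1 + 0.09 + 4 * 0.001 = 1.094`.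
  refine AVD.tendsto_probStops (n := n) (x := 11 / 10 / s) (θ := 996 / 1000) hc hρ
    (fun u => hmax ▸ G.degree_le_maxDegree u) hN (by omega) (by unfold AVD.q; omega)
    (Nat.cast_pos (α := ℝ).1 hs0) ?_ (by positivity) ?_ (by norm_num) (by norm_num) ?_
  · have : (n : ℝ) ≤ ((3 * d : ℕ) : ℝ) := by push_cast; linarith
    exact_mod_cast this
  · rw [div_le_one hs0]; linarith
  · have e1 := AVD.choose_mul_pow_le hs0 hnd hs
    have hx0 : 0 ≤ 11 / 10 / s := by positivity
    have e2 := AVD.mul_pow_le_of_mul_sq_le (k := 1) (a := 256) hn' hx0 hxn (by norm_num)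
      (by norm_num)
    have e3 := AVD.mul_pow_le_of_mul_sq_le (k := 2) (a := 2 ^ 26) hn' hx0 hxn (by norm_num)
      (by norm_num)
    have e4 := AVD.mul_pow_le_of_mul_sq_le (k := 3) (a := 2 ^ 27) hn' hx0 hxn (by norm_num)
      (by norm_num)
    have e5 := AVD.mul_pow_le_of_mul_sq_le (k := 4) (a := 2 ^ 26) hn' hx0 hxn (by norm_num)
      (by norm_num)
    have e6 : s * (11 / 10 / s) * (996 / 1000) = 10956 / 10000 := by
      field_simp; norm_num
    rw [e6]
    push_cast at e1 e2 e3 e4 e5 ⊢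
    norm_num at e1 e2 e3 e4 e5 ⊢
    linarith
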